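/- Let $\Pi=\{z=x+iy: y>0\}$ be the upper half-plane with area measure $dA$, and let $\|\cdot\|$ be the norm of $L^2(\Pi,dA)$. For $n\ge 1$ let $\mathcal A_n$ be the space of those $f\in L^2(\Pi,dA)$ that are smooth on $\Pi$ and satisfy $\bar\partial^{\,n}f=0$ (so $\mathcal A_1$ is the Bergman space), and let $\mathcal A_{(1)}=\mathcal A_1$ and $\mathcal A_{(n)}=\mathcal A_n\cap\mathcal A_{n-1}^{\perp}$ for $n\ge2$ be the true poly-Bergman spaces. Let $\mu$ be a complex Borel measure on $\Pi$, with finite variation $|\mu|$ on compact subsets of $\Pi$ (but $|\mu|(\Pi)=\infty$ is allowed). For an integer $k\ge 0$, such a measure $\mu$ is called a Carleson measure for derivatives of order $k$ ($k$-C measure) for $\mathcal A_1$ if there is a constant $C>0$ such that, for all $f\in\mathcal A_1$, the integral below converges absolutely and $$\left|\int_\Pi|\partial^k f|^2\,d\mu\right|\le C\|f\|^2 .$$ It is called a vanishing $k$-C measure if, in addition, $\int_\Pi|\partial^kf_n|^2\,d|\mu|\to0$ for every sequence $(f_n)$ that is bounded in $\mathcal A_1$ and converges to $0$ uniformly on compact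 subsets of $\Pi$. **Theorem.** Let $j\ge0$ be an integer and suppose that $y^k\mu$ is a $k$-C measure for $\mathcal A_1$ for every $k=0,1,\dots,2j$. Then for all $f,g\in\mathcal A_{(j+1)}$ the integral $F_\mu[f,g]=\int_\Pi f\bar g\,d\mu$ (formed with the smooth representatives) converges absolutely, the sesquilinear form $F_\mu$ is bounded on $\mathcal A_{(j+1)}$, that is, $|F_\mu[f,g]|\le C'\|f\|\,\|g\|$ for some constant $C'$, and it defines a bounded Toeplitz operator on $\mathcal A_{(j+1)}$: there is a unique bounded linear operator $T$ on $\mathcal A_{(j+1)}$ with $\langle Tf,g\rangle=F_\mu[f,g]$ for all $f,g\in\mathcal A_{(j+1)}$. If, moreover, $y^k\mu$ is a vanishing $k$-C measure for $\mathcal A_1$ for every $k=0,1,\dots,2j$, then $T$ is compact. -/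

import Mathlib

open MeasureTheory Filter Topology
open scoped ContDiff ComplexConjugate InnerProductSpace

noncomputable section

namespace PolyBergman

/-- The open upper half-plane `Π = {z : Im z > 0}`. -/
def upperPlane : Set ℂ := {z | 0 < z.im}

theorem isOpen_upperPlane : IsOpen upperPlane :=
  isOpen_lt continuous_const Complex.continuous_im

/-- Lebesgue (area) measure `dA` on `Π`. -/
def area : Measure ℂ := volume.restrict upperPlane

/-- The Cauchy-Riemann operator `∂̄ = (∂_x + i ∂_y) / 2`. -/
def dbar (f : ℂ → ℂ) (z : ℂ) : ℂ :=
  (1 / 2) * (fderiv ℝ f z 1 + Complex.I * fderiv ℝ f z Complex.I)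

/-- `f` is `n`-polyanalytic on `Π`: smooth there, with `∂̄ⁿ f = 0`. -/
def IsPolyanalytic (n : ℕ) (f : ℂ → ℂ) : Prop :=
  ContDiffOn ℝ ∞ f upperPlane ∧ ∀ z ∈ upperPlane, dbar^[n] f z = 0

theorem dbar_congr {f g : ℂ → ℂ} (h : Set.EqOn f g upperPlane) :
    Set.EqOn (dbar f) (dbar g) upperPlane := by
  intro z hz
  have : f =ᶠ[𝓝 z] g := h.eventuallyEq_of_mem (isOpen_upperPlane.mem_nhds hz)
  simp only [dbar, this.fderiv_eq]

theorem dbar_iterate_congr (n : ℕ) {f g : ℂ → ℂ} (h : Set.EqOn f g upperPlane) :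
    Set.EqOn (dbar^[n] f) (dbar^[n] g) upperPlane := by
  induction n generalizing f g with
  | zero => exact h
  | succ n ih => exact ih (dbar_congr h)

theorem contDiffOn_dbar {f : ℂ → ℂ} (hf : ContDiffOn ℝ ∞ f upperPlane) :
    ContDiffOn ℝ ∞ (dbar f) upperPlane := by
  have h : ContDiffOn ℝ ∞ (fderiv ℝ f) upperPlane :=
    hf.fderiv_of_isOpen isOpen_upperPlane (by simp)
  exact contDiffOn_const.mul
    ((h.clm_apply contDiffOn_const).add (contDiffOn_const.mul (h.clm_apply contDiffOn_const)))

theorem dbar_iterate_add (n : ℕ) {f g : ℂ → ℂ} (hf : ContDiffOn ℝ ∞ f upperPlane)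
    (hg : ContDiffOn ℝ ∞ g upperPlane) :
    Set.EqOn (dbar^[n] (f + g)) (dbar^[n] f + dbar^[n] g) upperPlane := by
  induction n generalizing f g with
  | zero => intro z _; rfl
  | succ n ih =>
    have h1 : Set.EqOn (dbar (f + g)) (dbar f + dbar g) upperPlane := by
      intro z hz
      have hz' := isOpen_upperPlane.mem_nhds hz
      have hf' : DifferentiableAt ℝ f z := (hf.contDiffAt hz').differentiableAt (by simp)
      have hg' : DifferentiableAt ℝ g z := (hg.contDiffAt hz').differentiableAt (by simp)
      simp only [dbar, Pi.add_apply, fderiv_add hf' hg', add_apply]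
      ring
    exact (dbar_iterate_congr n h1).trans (ih (contDiffOn_dbar hf) (contDiffOn_dbar hg))

theorem dbar_iterate_smul (n : ℕ) (c : ℂ) {f : ℂ → ℂ} (hf : ContDiffOn ℝ ∞ f upperPlane) :
    Set.EqOn (dbar^[n] (c • f)) (c • dbar^[n] f) upperPlane := by
  induction n generalizing f with
  | zero => intro z _; rfl
  | succ n ih =>
    have h1 : Set.EqOn (dbar (c • f)) (c • dbar f) upperPlane := by
      intro z hz
      have hz' := isOpen_upperPlane.mem_nhds hz
      have hf' : DifferentiableAt ℝ f z := (hf.contDiffAt hz').differentiableAt (by simp)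
      simp only [dbar, Pi.smul_apply, fderiv_const_smul hf' c, smul_apply,
        smul_eq_mul]
      ring
    exact (dbar_iterate_congr n h1).trans (ih (contDiffOn_dbar hf))

theorem IsPolyanalytic.add {n : ℕ} {f g : ℂ → ℂ} (hf : IsPolyanalytic n f)
    (hg : IsPolyanalytic n g) : IsPolyanalytic n (f + g) :=
  ⟨hf.1.add hg.1, fun z hz => by
    rw [dbar_iterate_add n hf.1 hg.1 hz, Pi.add_apply, hf.2 z hz, hg.2 z hz, add_zero]⟩

theorem IsPolyanalytic.smul {n : ℕ} (c : ℂ) {f : ℂ → ℂ} (hf : IsPolyanalytic n f) :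
    IsPolyanalytic n (c • f) :=
  ⟨contDiffOn_const.smul hf.1, fun z hz => by
    rw [dbar_iterate_smul n c hf.1 hz, Pi.smul_apply, hf.2 z hz, smul_zero]⟩

theorem isPolyanalytic_zero (n : ℕ) : IsPolyanalytic n 0 := by
  refine ⟨contDiffOn_const, fun z hz => ?_⟩
  have h := dbar_iterate_smul n 0 (f := 0) contDiffOn_const hz
  simpa using h

/-- `1`-polyanalytic functions are exactly the holomorphic ones. -/
theorem isPolyanalytic_one_iff (f : ℂ → ℂ) :
    IsPolyanalytic 1 f ↔ DifferentiableOn ℂ f upperPlane := by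
  constructor
  · rintro ⟨h1, h2⟩ z hz
    have hd : DifferentiableAt ℝ f z :=
      (h1.contDiffAt (isOpen_upperPlane.mem_nhds hz)).differentiableAt (by simp)
    refine (differentiableAt_complex_iff_differentiableAt_real.2
      ⟨hd, ?_⟩).differentiableWithinAt
    have h := h2 z hz
    simp only [Function.iterate_one, dbar] at h
    have h' : fderiv ℝ f z 1 = -(Complex.I * fderiv ℝ f z Complex.I) := by
      linear_combination 2 * h
    rw [h', smul_eq_mul, mul_neg, ← mul_assoc, Complex.I_mul_I]
    ring
  · intro h
    refine ⟨fun z hz => ?_, fun z hz => ?_⟩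
    · have ha : AnalyticAt ℂ f z := h.analyticAt (isOpen_upperPlane.mem_nhds hz)
      exact (ha.contDiffAt.restrict_scalars ℝ).contDiffWithinAt
    · have hd := (differentiableAt_complex_iff_differentiableAt_real.1
        (h.differentiableAt (isOpen_upperPlane.mem_nhds hz))).2
      simp only [Function.iterate_one, dbar, hd, smul_eq_mul, ← mul_assoc, Complex.I_mul_I]
      ring

/-- The poly-Bergman space `A_n`: the elements of `L²(Π, dA)` which are `n`-polyanalytic
(that is, have an `n`-polyanalytic representative). `A_1` is the Bergman space. -/
def polyBergman (n : ℕ) : Submodule ℂ (Lp ℂ 2 area) where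
  carrier := {u | ∃ f : ℂ → ℂ, IsPolyanalytic n f ∧ u =ᵐ[area] f}
  zero_mem' := ⟨0, isPolyanalytic_zero n, Lp.coeFn_zero _ _ _⟩
  add_mem' := by
    rintro u v ⟨f, hf, hu⟩ ⟨g, hg, hv⟩
    exact ⟨f + g, hf.add hg, (Lp.coeFn_add u v).trans (hu.add hv)⟩
  smul_mem' := by
    rintro c u ⟨f, hf, hu⟩
    exact ⟨c • f, hf.smul c, (Lp.coeFn_smul c u).trans (hu.const_smul c)⟩

theorem polyBergman_zero : polyBergman 0 = ⊥ := by
  refine (Submodule.eq_bot_iff _).2 ?_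
  rintro u ⟨f, hf, hu⟩
  refine (Lp.eq_zero_iff_ae_eq_zero).2 (hu.trans ?_)
  exact (ae_restrict_iff' isOpen_upperPlane.measurableSet).2 (Eventually.of_forall hf.2)

/-- The true poly-Bergman space `A_(n) = A_n ∩ A_{n-1}^⊥`, `n ≥ 1`. As `A_0 = 0`, this gives
`A_(1) = A_1`. -/
def trueBergman (n : ℕ) : Submodule ℂ (Lp ℂ 2 area) :=
  polyBergman n ⊓ (polyBergman (n - 1))ᗮ

theorem trueBergman_one : trueBergman 1 = polyBergman 1 := by
  simp [trueBergman, polyBergman_zero]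

/-- The smooth representative of an element of `A_(n)`. -/
def smoothRep {n : ℕ} (u : trueBergman n) : ℂ → ℂ :=
  Classical.choose u.2.1

theorem smoothRep_spec {n : ℕ} (u : trueBergman n) :
    IsPolyanalytic n (smoothRep u) ∧ (u : Lp ℂ 2 area) =ᵐ[area] smoothRep u :=
  Classical.choose_spec u.2.1

/-- The values on `Π` of the smooth representative do not depend on the choice. -/
theorem smoothRep_eqOn {n : ℕ} (u : trueBergman n) {f : ℂ → ℂ}
    (hf : ContinuousOn f upperPlane) (hu : (u : Lp ℂ 2 area) =ᵐ[area] f) :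
    Set.EqOn (smoothRep u) f upperPlane :=
  Measure.eqOn_open_of_ae_eq ((smoothRep_spec u).2.symm.trans hu) isOpen_upperPlane
    (smoothRep_spec u).1.1.continuousOn hf

/-- A (locally finite, not necessarily finite) complex Borel measure `μ` on `Π`, given by its
polar decomposition `dμ = phase d|μ|`: the variation `|μ|` is a positive Borel measure
on `Π`, finite on compact subsets of `Π`, and `phase` is a Borel function of modulus one.
Positive measures are those with `phase = 1`. -/
structure PlaneMeasure where
  /-- the variation `|μ|` -/
  variation : Measure ℂ
  /-- the phase `dμ / d|μ|` -/
  phase : ℂ → ℂ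
  concentrated : variation upperPlaneᶜ = 0
  finite_on_compacts : ∀ K ⊆ upperPlane, IsCompact K → variation K < ⊤
  measurable_phase : Measurable phase
  norm_phase : ∀ z, ‖phase z‖ = 1

/-- The integral `∫_Π h dμ`. -/
def PlaneMeasure.integral (μ : PlaneMeasure) (h : ℂ → ℂ) : ℂ :=
  ∫ z, h z * μ.phase z ∂μ.variation

/-- The measure `y^k μ`, where `y = Im z`. -/
def PlaneMeasure.ypow (k : ℕ) (μ : PlaneMeasure) : PlaneMeasure where
  variation := μ.variation.withDensity fun z => ENNReal.ofReal (z.im ^ k)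
  phase := μ.phase
  concentrated := withDensity_absolutelyContinuous _ _ μ.concentrated
  finite_on_compacts := by
    intro K hK hc
    obtain ⟨M, hM⟩ := hc.bddAbove_image
      (f := fun z : ℂ => z.im ^ k) (Complex.continuous_im.pow k).continuousOn
    rw [withDensity_apply _ hc.measurableSet]
    calc ∫⁻ z in K, ENNReal.ofReal (z.im ^ k) ∂μ.variation
        ≤ ∫⁻ _ in K, ENNReal.ofReal M ∂μ.variation :=
          setLIntegral_mono measurable_const fun z hz =>
            ENNReal.ofReal_le_ofReal (hM ⟨z, hz, rfl⟩)
      _ = ENNReal.ofReal M * μ.variation K := setLIntegral_const _ _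
      _ < ⊤ := ENNReal.mul_lt_top ENNReal.ofReal_lt_top (μ.finite_on_compacts K hK hc)
  measurable_phase := μ.measurable_phase
  norm_phase := μ.norm_phase

/-- `f` is a function in the Bergman space `A_1`: square integrable and holomorphic on `Π`. -/
def IsBergman (f : ℂ → ℂ) : Prop :=
  IsPolyanalytic 1 f ∧ MemLp f 2 area

/-- `μ` is a Carleson measure for derivatives of order `k` (`k`-C measure) for `A_1`:
for all `f ∈ A_1` the integral `∫ |∂^k f|² dμ` exists and `|∫ |∂^k f|² dμ| ≤ C ‖f‖²`. -/
def IsKCarleson (k : ℕ) (μ : PlaneMeasure) : Prop :=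
  ∃ C : ℝ, 0 < C ∧ ∀ f : ℂ → ℂ, IsBergman f →
    Integrable (fun z => ‖iteratedDeriv k f z‖ ^ 2) μ.variation ∧
    ‖μ.integral (fun z => ((‖iteratedDeriv k f z‖ ^ 2 : ℝ) : ℂ))‖ ≤ C * ∫ z, ‖f z‖ ^ 2 ∂area

/-- `μ` is a vanishing `k`-C measure for `A_1`: it is a `k`-C measure, and `∫ |∂^k f_n|² d|μ| → 0`
for each sequence `f_n` bounded in `A_1` that tends to `0` locally uniformly in `Π`. -/
def IsVanishingKCarleson (k : ℕ) (μ : PlaneMeasure) : Prop :=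
  IsKCarleson k μ ∧ ∀ f : ℕ → ℂ → ℂ, (∀ n, IsBergman (f n)) →
    (∃ M : ℝ, ∀ n, ∫ z, ‖f n z‖ ^ 2 ∂area ≤ M) →
    TendstoLocallyUniformlyOn f (fun _ => 0) atTop upperPlane →
    Tendsto (fun n => ∫⁻ z, ‖iteratedDeriv k (f n) z‖ₑ ^ 2 ∂μ.variation) atTop (𝓝 0)

/-- The sesquilinear form `F_μ[u, v] = ∫_Π u v̄ dμ` on `A_(n)`. -/
def form {n : ℕ} (μ : PlaneMeasure) (u v : trueBergman n) : ℂ :=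
  μ.integral fun z => smoothRep u z * conj (smoothRep v z)

/-- `T` is the Toeplitz operator in `A_(n)` defined by the form: `⟨T u, v⟩ = F_μ[u, v]`
(Mathlib's inner product is linear in the second argument). -/
def IsToeplitz {n : ℕ} (μ : PlaneMeasure) (T : trueBergman n →L[ℂ] trueBergman n) : Prop :=
  ∀ u v : trueBergman n, ⟪v, T u⟫_ℂ = form μ u v

end PolyBergman

end

/-!
The hypothesis for `k = 0` already carries the result. It says that `∫ |f|² d|μ|` is finite for each
`f` in the Bergman space, and the closed graph theorem turns this into a uniform bound
(`IsKCarleson.exists_lintegral_le`). Testing with the functions `Im w / (z - conj w)²`, whose `L²`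
norms are bounded, shows that the density `|μ|(D(w, Im w / 3)) / (Im w)²` is bounded
(`IsKCarleson.exists_density_le`), and that it tends to `0` at the boundary of `Π` if `μ` is
vanishing (`IsVanishingKCarleson.exists_density_le`).

The passage from holomorphic to polyanalytic functions rests on the sub-mean value inequality
`|f(a)|² ≤ C ρ⁻² ∫_{D(a, ρ)} |f|²` (`exists_norm_sq_le_setIntegral_ball`). An `(n+1)`-polyanalytic
function is `conj (z - a) ^ n * h z` plus an `n`-polyanalytic one, with `h` holomorphic. By
orthogonality on circles, `h a` is a multiple of the moment `∫_{D(a, ρ)} (w - a) ^ n f(w)`, hence is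
controlled by the `L²` norm, and the inequality follows by induction on `n`. The same bound for `h`
shows that polyanalyticity passes to `L²` limits, so that the poly-Bergman spaces are complete
(`isClosed_polyBergman`).

Integrating the inequality against `|μ|` and applying Tonelli's theorem gives
`∫ |f|² d|μ| ≤ C ∫ |f|² density dA` (`exists_lintegral_variation_le`). A bounded density therefore
gives a bounded embedding `J` of `A_(n)` into `L²(|μ|)`, and the Toeplitz operator is
`J* ∘ (phase of μ) ∘ J`. If the density vanishes at the boundary, `J` maps bounded sequences
converging to `0` pointwise to null sequences, and is compact by weak sequential compactness of
balls in a separable Hilbert space.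
-/

noncomputable section

namespace PolyBergman

/-! ### Polyanalytic functions and their leading coefficients -/

theorem dbar_conj_sub_pow_succ_mul (a : ℂ) (k : ℕ) {h : ℂ → ℂ}
    (hh : DifferentiableOn ℂ h upperPlane) :
    Set.EqOn (dbar fun z => conj (z - a) ^ (k + 1) * h z)
      ((k + 1 : ℂ) • fun z => conj (z - a) ^ k * h z) upperPlane := by
  intro z hz
  have h1 : HasFDerivAt (fun z : ℂ => conj (z - a)) (Complex.conjCLE : ℂ →L[ℝ] ℂ) z :=
    Complex.conjCLE.hasFDerivAt.comp z ((hasFDerivAt_id z).sub_const a)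
  have h2 := (hh.differentiableAt (isOpen_upperPlane.mem_nhds hz)).hasDerivAt.hasFDerivAt
    |>.restrictScalars ℝ
  have h3 := ((h1.pow (k + 1)).mul h2).fderiv
  simp only [dbar, Pi.smul_apply, smul_eq_mul]
  rw [show (fun z => conj (z - a) ^ (k + 1) * h z)
    = (fun z : ℂ => conj (z - a) ^ (k + 1)) * h from rfl, h3]
  simp
  ring_nf
  simp
  ring

theorem contDiffOn_conj_sub_pow_mul (a : ℂ) (k : ℕ) {h : ℂ → ℂ}
    (hh : DifferentiableOn ℂ h upperPlane) :
    ContDiffOn ℝ ∞ (fun z => conj (z - a) ^ k * h z) upperPlane := by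
  have h1 : ContDiff ℝ ∞ fun z : ℂ => conj (z - a) :=
    Complex.conjCLE.contDiff.comp (contDiff_id.sub contDiff_const)
  exact (h1.pow k).contDiffOn.mul ((isPolyanalytic_one_iff h).2 hh).1

theorem dbar_iterate_conj_sub_pow_mul (a : ℂ) (k : ℕ) {h : ℂ → ℂ}
    (hh : DifferentiableOn ℂ h upperPlane) :
    Set.EqOn (dbar^[k] fun z => conj (z - a) ^ k * h z) ((k.factorial : ℂ) • h) upperPlane := by
  induction k with
  | zero => intro z _; simp
  | succ k ih =>
    refine (dbar_iterate_congr k (dbar_conj_sub_pow_succ_mul a k hh)).trans ?_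
    refine (dbar_iterate_smul k _ (contDiffOn_conj_sub_pow_mul a k hh)).trans ?_
    intro z hz
    rw [Pi.smul_apply, ih hz]
    simp [Nat.factorial_succ, mul_assoc]

theorem IsPolyanalytic.sub {n : ℕ} {f g : ℂ → ℂ} (hf : IsPolyanalytic n f)
    (hg : IsPolyanalytic n g) : IsPolyanalytic n (f - g) := by
  simpa [sub_eq_add_neg] using hf.add (hg.smul (-1))

theorem IsPolyanalytic.succ {n : ℕ} {f : ℂ → ℂ} (hf : IsPolyanalytic n f) :
    IsPolyanalytic (n + 1) f := by
  refine ⟨hf.1, fun z hz => ?_⟩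
  rw [Function.iterate_succ_apply', dbar_congr (g := fun _ => 0) hf.2 hz]
  simp [dbar]

theorem isPolyanalytic_conj_sub_pow_mul (a : ℂ) (n : ℕ) {h : ℂ → ℂ}
    (hh : DifferentiableOn ℂ h upperPlane) :
    IsPolyanalytic (n + 1) fun z => conj (z - a) ^ n * h z := by
  refine ⟨contDiffOn_conj_sub_pow_mul a n hh, fun z hz => ?_⟩
  rw [Function.iterate_succ_apply', dbar_congr (dbar_iterate_conj_sub_pow_mul a n hh) hz]
  exact ((isPolyanalytic_one_iff _).2 (hh.const_smul _)).2 z hz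

/-- `h` is the leading coefficient (the one of `conj (z - a) ^ n`) of the `(n+1)`-polyanalytic
function `f`; it does not depend on the centre `a`. -/
def IsLeadingCoeff (n : ℕ) (f h : ℂ → ℂ) : Prop :=
  DifferentiableOn ℂ h upperPlane ∧ ∀ a, IsPolyanalytic n fun z => f z - conj (z - a) ^ n * h z

theorem IsLeadingCoeff.sub {n : ℕ} {f h f' h' : ℂ → ℂ} (H : IsLeadingCoeff n f h)
    (H' : IsLeadingCoeff n f' h') : IsLeadingCoeff n (f - f') (h - h') := by
  refine ⟨H.1.sub H'.1, fun a => ?_⟩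
  convert (H.2 a).sub (H'.2 a) using 1
  ext z
  simp only [Pi.sub_apply]
  ring

/-- The leading coefficient is `∂̄ⁿ f / n!`. -/
theorem IsPolyanalytic.exists_leadingCoeff {n : ℕ} {f : ℂ → ℂ} (hf : IsPolyanalytic (n + 1) f) :
    ∃ h : ℂ → ℂ, IsLeadingCoeff n f h := by
  have hs : ∀ m, ContDiffOn ℝ ∞ (dbar^[m] f) upperPlane := by
    intro m
    induction m with
    | zero => exact hf.1
    | succ m ih => rw [Function.iterate_succ_apply']; exact contDiffOn_dbar ih
  have hd : DifferentiableOn ℂ (dbar^[n] f) upperPlane := by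
    refine (isPolyanalytic_one_iff _).1 ⟨hs n, fun z hz => ?_⟩
    have := hf.2 z hz
    rwa [Function.iterate_succ_apply'] at this
  have hh := hd.const_smul ((n.factorial : ℂ)⁻¹)
  refine ⟨_, hh, fun a => ?_⟩
  have hc := contDiffOn_conj_sub_pow_mul a n hh
  refine ⟨hf.1.sub hc, fun z hz => ?_⟩
  have e : (fun z => f z - conj (z - a) ^ n * ((n.factorial : ℂ)⁻¹ • dbar^[n] f) z)
      = f + (-1 : ℂ) • fun z => conj (z - a) ^ n * ((n.factorial : ℂ)⁻¹ • dbar^[n] f) z := by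
    ext z; simp [sub_eq_add_neg]
  have hn : (n.factorial : ℂ) ≠ 0 := by exact_mod_cast n.factorial_ne_zero
  rw [e]
  refine (dbar_iterate_add n hf.1 (hc.const_smul (-1 : ℂ)) hz).trans ?_
  rw [Pi.add_apply]
  refine (congrArg (dbar^[n] f z + ·) (dbar_iterate_smul n (-1) hc hz)).trans ?_
  refine (congrArg (fun t => dbar^[n] f z + (-1 : ℂ) • t)
    (dbar_iterate_conj_sub_pow_mul a n hh hz)).trans ?_
  simp [hn]

/-! ### Moments over discs -/

/-- Integration over a disc in polar coordinates. -/
theorem setIntegral_ball_eq_circleAverage {F : ℂ → ℂ} {a : ℂ} {ρ : ℝ} (hρ : 0 < ρ)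
    (hF : ContinuousOn F (Metric.closedBall a ρ)) :
    ∫ z in Metric.ball a ρ, F z
      = ∫ r in (0)..ρ, ((2 * Real.pi * r : ℝ) : ℂ) * Real.circleAverage F a r := by
  set G : ℂ → ℂ := (Metric.ball a ρ).indicator F with hG
  have hmap : ∀ r θ : ℝ, a + Complex.polarCoord.symm (r, θ) = circleMap a r θ := by
    intro r θ
    simp [circleMap, Complex.polarCoord_symm_apply, Complex.exp_mul_I]
  have hc : ContinuousOn (fun p : ℝ × ℝ => p.1 • F (circleMap a p.1 p.2))
      (Set.Icc 0 ρ ×ˢ Set.Icc (-Real.pi) Real.pi) := by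
    refine continuousOn_fst.smul (hF.comp (Continuous.continuousOn ?_) ?_)
    · unfold circleMap; fun_prop
    · rintro ⟨r, θ⟩ ⟨⟨h0, h1⟩, -⟩
      simpa [circleMap, abs_of_nonneg h0] using h1
  have hint : IntegrableOn (fun p : ℝ × ℝ => p.1 • F (circleMap a p.1 p.2))
      (Set.Ioo 0 ρ ×ˢ Set.Ioo (-Real.pi) Real.pi) :=
    (hc.integrableOn_compact (isCompact_Icc.prod isCompact_Icc)).mono_set
      (Set.prod_mono Set.Ioo_subset_Icc_self Set.Ioo_subset_Icc_self)
  calc ∫ z in Metric.ball a ρ, F z = ∫ z, G z := (integral_indicator measurableSet_ball).symm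
    _ = ∫ z, G (a + z) := (integral_add_left_eq_self G a).symm
    _ = ∫ p in polarCoord.target, p.1 • G (a + Complex.polarCoord.symm p) :=
        (Complex.integral_comp_polarCoord_symm fun z => G (a + z)).symm
    _ = ∫ p in Set.Ioo 0 ρ ×ˢ Set.Ioo (-Real.pi) Real.pi, p.1 • F (circleMap a p.1 p.2) := by
        have hm : MeasurableSet (Set.Ioo 0 ρ ×ˢ Set.Ioo (-Real.pi) Real.pi) :=
          measurableSet_Ioo.prod measurableSet_Ioo
        have hm' : MeasurableSet polarCoord.target := polarCoord.open_target.measurableSet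
        rw [← integral_indicator hm, ← integral_indicator hm']
        congr 1
        ext ⟨r, θ⟩
        simp only [Set.indicator_apply, hmap]
        by_cases hr : 0 < r <;> by_cases hr' : r < ρ <;>
          simp [Set.indicator, polarCoord_target, hG, hr, hr', circleMap, abs_of_pos]
    _ = ∫ r in Set.Ioo 0 ρ, ∫ θ in Set.Ioo (-Real.pi) Real.pi, r • F (circleMap a r θ) :=
        setIntegral_prod _ hint
    _ = ∫ r in (0)..ρ, ((2 * Real.pi * r : ℝ) : ℂ) * Real.circleAverage F a r := by
        rw [intervalIntegral.integral_of_le hρ.le, ← integral_Ioc_eq_integral_Ioo]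
        congr 1
        ext r
        have hp : Function.Periodic (fun θ => F (circleMap a r θ)) (2 * Real.pi) := fun θ => by
          simp only [periodic_circleMap a r θ]
        have h2 := hp.intervalIntegral_add_eq (-Real.pi) 0
        rw [integral_smul, ← integral_Ioc_eq_integral_Ioo,
          ← intervalIntegral.integral_of_le (by linarith [Real.pi_pos]), Real.circleAverage]
        rw [show -Real.pi + 2 * Real.pi = Real.pi by ring, zero_add] at h2
        rw [h2, Complex.real_smul, Complex.real_smul]
        have := Real.pi_ne_zero
        push_cast
        field_simp

/-- Moments of a holomorphic function: on the circle `|w - a| = r` the integrand equals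
`r ^ (2k) (w - a) ^ (m - k) g w`, to which the mean value property applies. -/
theorem setIntegral_ball_moment {g : ℂ → ℂ} (hg : DifferentiableOn ℂ g upperPlane) {a : ℂ} {ρ : ℝ}
    (hρ : 0 < ρ) (hb : Metric.closedBall a ρ ⊆ upperPlane) {m k : ℕ} (hk : k ≤ m) :
    ∫ w in Metric.ball a ρ, (w - a) ^ m * (conj (w - a) ^ k * g w)
      = Real.pi * ρ ^ (2 * k + 2) / (k + 1) * (0 ^ (m - k) * g a) := by
  have hcont : ContinuousOn (fun w => (w - a) ^ m * (conj (w - a) ^ k * g w))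
      (Metric.closedBall a ρ) := by
    refine ContinuousOn.mul (by fun_prop) (ContinuousOn.mul (Continuous.continuousOn ?_)
      (hg.continuousOn.mono hb))
    exact (Complex.continuous_conj.comp (continuous_id.sub continuous_const)).pow k
  rw [setIntegral_ball_eq_circleAverage hρ hcont]
  have key : Set.EqOn (fun r : ℝ => ((2 * Real.pi * r : ℝ) : ℂ) *
      Real.circleAverage (fun w => (w - a) ^ m * (conj (w - a) ^ k * g w)) a r)
      (fun r : ℝ => (2 * Real.pi * (0 ^ (m - k) * g a)) * ((r ^ (2 * k + 1) : ℝ) : ℂ))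
      (Set.uIcc 0 ρ) := by
    intro r hr
    rw [Set.uIcc_of_le hρ.le] at hr
    have hd : DiffContOnCl ℂ (fun w => (w - a) ^ (m - k) * g w) (Metric.ball a |r|) := by
      have h1 : DifferentiableOn ℂ (fun w => (w - a) ^ (m - k) * g w) upperPlane :=
        DifferentiableOn.mul (by fun_prop) hg
      refine (h1.mono ?_).diffContOnCl
      refine Metric.closure_ball_subset_closedBall.trans
        ((Metric.closedBall_subset_closedBall ?_).trans hb)
      rw [abs_of_nonneg hr.1]; exact hr.2
    have h2 : Real.circleAverage (fun w => (w - a) ^ m * (conj (w - a) ^ k * g w)) a r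
        = Real.circleAverage (((r ^ (2 * k) : ℝ) : ℂ) • fun w => (w - a) ^ (m - k) * g w) a r := by
      refine Real.circleAverage_congr_sphere fun w hw => ?_
      have hw' : ‖w - a‖ = |r| := by simpa [dist_eq_norm] using hw
      have h3 : (w - a) * conj (w - a) = ((r ^ 2 : ℝ) : ℂ) := by
        rw [Complex.mul_conj, Complex.normSq_eq_norm_sq, hw', sq_abs]
      simp only [Pi.smul_apply, smul_eq_mul]
      calc (w - a) ^ m * (conj (w - a) ^ k * g w)
          = ((w - a) * conj (w - a)) ^ k * ((w - a) ^ (m - k) * g w) := by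
            rw [mul_pow, ← Nat.sub_add_cancel hk, pow_add, Nat.add_sub_cancel]; ring
        _ = _ := by rw [h3]; push_cast; ring
    simp only
    rw [h2, Real.circleAverage_smul, hd.circleAverage]
    simp
    ring
  rw [intervalIntegral.integral_congr key, intervalIntegral.integral_const_mul,
    intervalIntegral.integral_ofReal, integral_pow]
  push_cast
  have : (k : ℂ) + 1 ≠ 0 := by exact_mod_cast k.succ_ne_zero
  have h3 : (2 * (k : ℂ) + 1 + 1) = 2 * (k + 1) := by ring
  rw [h3]
  field_simp
  simp

/-! ### The sub-mean value inequality -/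

theorem continuous_conj_sub_pow (a : ℂ) (n : ℕ) : Continuous fun z : ℂ => conj (z - a) ^ n :=
  (Complex.continuous_conj.comp (continuous_id.sub continuous_const)).pow n

theorem norm_conj_sub_pow (a z : ℂ) (n : ℕ) : ‖conj (z - a) ^ n‖ = ‖z - a‖ ^ n := by
  rw [norm_pow, RCLike.norm_conj]

theorem integrableOn_ball_of_continuousOn {E : Type*} [NormedAddCommGroup E] {F : ℂ → E} {a : ℂ}
    {ρ : ℝ} (hF : ContinuousOn F (Metric.closedBall a ρ)) : IntegrableOn F (Metric.ball a ρ) :=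
  (hF.integrableOn_compact (isCompact_closedBall a ρ)).mono_set Metric.ball_subset_closedBall

theorem volume_real_ball (a : ℂ) {ρ : ℝ} (hρ : 0 ≤ ρ) :
    volume.real (Metric.ball a ρ) = Real.pi * ρ ^ 2 := by
  rw [Measure.real, Complex.volume_ball]
  simp [hρ, mul_comm]

theorem IsPolyanalytic.setIntegral_pow_mul_eq_zero {n : ℕ} {f : ℂ → ℂ} (hf : IsPolyanalytic n f)
    {a : ℂ} {ρ : ℝ} (hρ : 0 < ρ) (hb : Metric.closedBall a ρ ⊆ upperPlane) {m : ℕ} (hm : n ≤ m) :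
    ∫ w in Metric.ball a ρ, (w - a) ^ m * f w = 0 := by
  induction n generalizing f with
  | zero =>
    rw [setIntegral_congr_fun measurableSet_ball (g := fun _ => 0), integral_zero]
    intro w hw
    have := hf.2 w (hb (Metric.ball_subset_closedBall hw))
    simp_all
  | succ n ih =>
    obtain ⟨h, hh, hf'⟩ := hf.exists_leadingCoeff
    have c1 : ContinuousOn (fun w => (w - a) ^ m * (f w - conj (w - a) ^ n * h w))
        (Metric.closedBall a ρ) := ContinuousOn.mul (by fun_prop) ((hf' a).1.continuousOn.mono hb)
    have c2 : ContinuousOn (fun w => (w - a) ^ m * (conj (w - a) ^ n * h w))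
        (Metric.closedBall a ρ) := ContinuousOn.mul (by fun_prop)
          ((continuous_conj_sub_pow a n).continuousOn.mul (hh.continuousOn.mono hb))
    have := integral_add (integrableOn_ball_of_continuousOn c1)
      (integrableOn_ball_of_continuousOn c2)
    rw [ih (hf' a) (by omega), setIntegral_ball_moment hh hρ hb (by omega), zero_pow (by omega)]
      at this
    simpa [← mul_add] using this

theorem IsLeadingCoeff.setIntegral_pow_mul {n : ℕ} {f h : ℂ → ℂ} (H : IsLeadingCoeff n f h)
    {a : ℂ} {ρ : ℝ} (hρ : 0 < ρ) (hb : Metric.closedBall a ρ ⊆ upperPlane) :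
    ∫ w in Metric.ball a ρ, (w - a) ^ n * f w = Real.pi * ρ ^ (2 * n + 2) / (n + 1) * h a := by
  obtain ⟨hh, hf'⟩ := H
  have c1 : ContinuousOn (fun w => (w - a) ^ n * (f w - conj (w - a) ^ n * h w))
      (Metric.closedBall a ρ) := ContinuousOn.mul (by fun_prop) ((hf' a).1.continuousOn.mono hb)
  have c2 : ContinuousOn (fun w => (w - a) ^ n * (conj (w - a) ^ n * h w))
      (Metric.closedBall a ρ) := ContinuousOn.mul (by fun_prop)
        ((continuous_conj_sub_pow a n).continuousOn.mul (hh.continuousOn.mono hb))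
  have := integral_add (integrableOn_ball_of_continuousOn c1)
      (integrableOn_ball_of_continuousOn c2)
  rw [(hf' a).setIntegral_pow_mul_eq_zero hρ hb le_rfl, setIntegral_ball_moment hh hρ hb le_rfl]
    at this
  simpa [← mul_add] using this

theorem sq_setIntegral_ball_le {g : ℂ → ℝ} {a : ℂ} {ρ : ℝ} (hρ : 0 < ρ)
    (hg : ContinuousOn g (Metric.closedBall a ρ)) :
    (∫ w in Metric.ball a ρ, g w) ^ 2
      ≤ Real.pi * ρ ^ 2 * ∫ w in Metric.ball a ρ, g w ^ 2 := by
  set I := ∫ w in Metric.ball a ρ, g w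
  set V := Real.pi * ρ ^ 2 with hV
  have hVpos : 0 < V := by positivity
  have h0 : 0 ≤ ∫ w in Metric.ball a ρ, (g w - I / V) ^ 2 := integral_nonneg fun _ => sq_nonneg _
  have h1 : ∫ w in Metric.ball a ρ, (g w - I / V) ^ 2
      = (∫ w in Metric.ball a ρ, g w ^ 2) - 2 * (I / V) * I + (I / V) ^ 2 * V := by
    have e : ∀ w, (g w - I / V) ^ 2 = g w ^ 2 - 2 * (I / V) * g w + (I / V) ^ 2 := fun w => by ring
    have i1 : IntegrableOn (fun w => g w ^ 2) (Metric.ball a ρ) :=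
      integrableOn_ball_of_continuousOn (hg.pow 2)
    have i2 := (integrableOn_ball_of_continuousOn hg).const_mul (2 * (I / V))
    simp_rw [e]
    have i3 : IntegrableOn (fun w => g w ^ 2 - 2 * (I / V) * g w) (Metric.ball a ρ) := i1.sub i2
    rw [integral_add i3 (integrableOn_ball_of_continuousOn continuousOn_const),
      integral_sub i1 i2, integral_const_mul,
      setIntegral_const, volume_real_ball a hρ.le, smul_eq_mul]
    ring
  rw [h1] at h0
  have h2 : I / V * V = I := div_mul_cancel₀ _ hVpos.ne'
  have h3 : 0 ≤ V * ((∫ w in Metric.ball a ρ, g w ^ 2) - 2 * (I / V) * I + (I / V) ^ 2 * V) :=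
    mul_nonneg hVpos.le h0
  have h4 : V * ((∫ w in Metric.ball a ρ, g w ^ 2) - 2 * (I / V) * I + (I / V) ^ 2 * V)
      = V * (∫ w in Metric.ball a ρ, g w ^ 2) - 2 * (I / V * V) * I + (I / V * V) ^ 2 := by ring
  rw [h4, h2] at h3
  nlinarith

theorem IsLeadingCoeff.continuousOn {n : ℕ} {f h : ℂ → ℂ} (H : IsLeadingCoeff n f h) :
    ContinuousOn f upperPlane := by
  have := (H.2 0).1.continuousOn.add
    ((continuous_conj_sub_pow 0 n).continuousOn.mul H.1.continuousOn)
  exact this.congr fun z _ => by simp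

/-- The leading coefficient at the centre of a disc is controlled by the `L²` norm on the disc:
it is the moment of `f` against `(w - a) ^ n`, all lower terms having zero moment. -/
theorem IsLeadingCoeff.norm_sq_le {n : ℕ} {f h : ℂ → ℂ} (H : IsLeadingCoeff n f h)
    {a : ℂ} {ρ : ℝ} (hρ : 0 < ρ) (hb : Metric.closedBall a ρ ⊆ upperPlane) :
    ‖h a‖ ^ 2 * ρ ^ (2 * n + 2) ≤ (n + 1) ^ 2 * ∫ w in Metric.ball a ρ, ‖f w‖ ^ 2 := by
  have hf : ContinuousOn (fun w => ‖f w‖) (Metric.closedBall a ρ) :=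
    (H.continuousOn.mono hb).norm
  have h1 : ‖∫ w in Metric.ball a ρ, (w - a) ^ n * f w‖
      ≤ ρ ^ n * ∫ w in Metric.ball a ρ, ‖f w‖ := by
    rw [← integral_const_mul]
    refine norm_integral_le_of_norm_le ((integrableOn_ball_of_continuousOn hf).const_mul _) ?_
    refine (ae_restrict_iff' measurableSet_ball).2 (Eventually.of_forall fun w hw => ?_)
    rw [norm_mul, norm_pow]
    gcongr
    exact (mem_ball_iff_norm.1 hw).le
  rw [H.setIntegral_pow_mul hρ hb] at h1
  have h2 : ‖(Real.pi * ρ ^ (2 * n + 2) / (n + 1) * h a : ℂ)‖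
      = Real.pi * ρ ^ (2 * n + 2) / (n + 1) * ‖h a‖ := by
    have : (Real.pi * ρ ^ (2 * n + 2) / (n + 1) : ℂ)
        = ((Real.pi * ρ ^ (2 * n + 2) / (n + 1) : ℝ) : ℂ) := by push_cast; rfl
    rw [norm_mul, this, Complex.norm_real, Real.norm_of_nonneg (by positivity)]
  rw [h2] at h1
  have h3 := sq_setIntegral_ball_le hρ hf
  set I := ∫ w in Metric.ball a ρ, ‖f w‖
  set J := ∫ w in Metric.ball a ρ, ‖f w‖ ^ 2
  have hJ : 0 ≤ J := integral_nonneg fun _ => sq_nonneg _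
  have h4 : (Real.pi * ρ ^ (2 * n + 2) / (n + 1) * ‖h a‖) ^ 2
      ≤ (ρ ^ n) ^ 2 * (Real.pi * ρ ^ 2 * J) := by
    calc _ ≤ (ρ ^ n * I) ^ 2 := by gcongr
      _ = (ρ ^ n) ^ 2 * I ^ 2 := by ring
      _ ≤ _ := by gcongr
  have h5 : Real.pi * ρ ^ (2 * n + 2) * (Real.pi * (‖h a‖ ^ 2 * ρ ^ (2 * n + 2)))
      ≤ Real.pi * ρ ^ (2 * n + 2) * ((n + 1) ^ 2 * J) := by
    have : (Real.pi * ρ ^ (2 * n + 2) / (n + 1) * ‖h a‖) ^ 2 * (n + 1) ^ 2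
        = Real.pi * ρ ^ (2 * n + 2) * (Real.pi * (‖h a‖ ^ 2 * ρ ^ (2 * n + 2))) := by
      field_simp
    rw [← this]
    calc _ ≤ (ρ ^ n) ^ 2 * (Real.pi * ρ ^ 2 * J) * (n + 1) ^ 2 := by gcongr
      _ = _ := by ring
  have h6 := le_of_mul_le_mul_left h5 (by positivity)
  have h7 : 0 ≤ ‖h a‖ ^ 2 * ρ ^ (2 * n + 2) := by positivity
  nlinarith [Real.pi_gt_three]

/-- Polyanalytic functions satisfy an `L²` sub-mean value inequality. -/
theorem exists_norm_sq_le_setIntegral_ball (n : ℕ) : ∃ C : ℝ, 0 < C ∧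
    ∀ f : ℂ → ℂ, IsPolyanalytic n f → ∀ (a : ℂ) (ρ : ℝ), 0 < ρ →
      Metric.closedBall a ρ ⊆ upperPlane →
      ‖f a‖ ^ 2 * ρ ^ 2 ≤ C * ∫ w in Metric.ball a ρ, ‖f w‖ ^ 2 := by
  induction n with
  | zero =>
    refine ⟨1, one_pos, fun f hf a ρ hρ hb => ?_⟩
    have : f a = 0 := hf.2 a (hb (Metric.mem_closedBall_self hρ.le))
    rw [this, norm_zero, zero_pow two_ne_zero, zero_mul, one_mul]
    exact integral_nonneg fun _ => sq_nonneg _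
  | succ n ih =>
    obtain ⟨C, hC, ih⟩ := ih
    refine ⟨16 * (C * (1 + Real.pi * (n + 1) ^ 2)) + 1, by positivity, fun f hf a ρ hρ hb => ?_⟩
    obtain ⟨h, H⟩ := hf.exists_leadingCoeff
    set J := ∫ w in Metric.ball a ρ, ‖f w‖ ^ 2
    have hJ : 0 ≤ J := integral_nonneg fun _ => sq_nonneg _
    rcases Nat.eq_zero_or_pos n with rfl | hn
    · have h0 : f a = h a := by
        have := (H.2 a).2 a (hb (Metric.mem_closedBall_self hρ.le))
        simpa [sub_eq_zero] using this
      have := H.norm_sq_le hρ hb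
      rw [h0]
      norm_num at this ⊢
      have : 0 ≤ 16 * (C * (1 + Real.pi)) * J := by positivity
      nlinarith
    · set g := fun z => f z - conj (z - a) ^ n * h z
      have hga : f a = g a := by simp [g, hn.ne']
      have hρ2 : 0 < ρ / 2 := by positivity
      have hb2 : Metric.closedBall a (ρ / 2) ⊆ upperPlane :=
        (Metric.closedBall_subset_closedBall (by linarith)).trans hb
      have hg := ih g (H.2 a) a (ρ / 2) hρ2 hb2
      -- for `w` in the half-size disc, `h w` is bounded through the disc `D(w, ρ / 2) ⊆ D(a, ρ)`
      have hfc : IntegrableOn (fun w => ‖f w‖ ^ 2) (Metric.ball a ρ) :=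
        integrableOn_ball_of_continuousOn
          ((H.continuousOn.mono hb).norm.pow 2)
      have hsub : Metric.ball a (ρ / 2) ⊆ Metric.ball a ρ := Metric.ball_subset_ball (by linarith)
      have hpt : ∀ w ∈ Metric.ball a (ρ / 2),
          ‖g w‖ ^ 2 ≤ 2 * ‖f w‖ ^ 2 + 2 * ((n + 1) ^ 2 * J / (ρ / 2) ^ 2) := by
        intro w hw
        have hw' : ‖w - a‖ ≤ ρ / 2 := (mem_ball_iff_norm.1 hw).le
        have hwb : Metric.closedBall w (ρ / 2) ⊆ upperPlane := by
          refine (Metric.closedBall_subset_closedBall' ?_).trans hb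
          rw [dist_eq_norm]; linarith
        have hwb' : Metric.ball w (ρ / 2) ⊆ Metric.ball a ρ := by
          refine Metric.ball_subset_ball' ?_
          rw [dist_eq_norm]; linarith
        have h1 := H.norm_sq_le hρ2 hwb
        have h2 : ∫ z in Metric.ball w (ρ / 2), ‖f z‖ ^ 2 ≤ J :=
          setIntegral_mono_set hfc (Eventually.of_forall fun _ => sq_nonneg _)
            hwb'.eventuallyLE
        have h3 : ‖conj (w - a) ^ n * h w‖ ^ 2 ≤ (n + 1) ^ 2 * J / (ρ / 2) ^ 2 := by
          rw [le_div_iff₀ (by positivity), norm_mul, norm_conj_sub_pow]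
          calc (‖w - a‖ ^ n * ‖h w‖) ^ 2 * (ρ / 2) ^ 2
              ≤ ((ρ / 2) ^ n * ‖h w‖) ^ 2 * (ρ / 2) ^ 2 := by gcongr
            _ = ‖h w‖ ^ 2 * (ρ / 2) ^ (2 * n + 2) := by ring
            _ ≤ _ := h1.trans (by gcongr)
        have h4 : ‖g w‖ ≤ ‖f w‖ + ‖conj (w - a) ^ n * h w‖ := norm_sub_le _ _
        nlinarith [norm_nonneg (g w), sq_nonneg (‖f w‖ - ‖conj (w - a) ^ n * h w‖)]
      have hgc : IntegrableOn (fun w => ‖g w‖ ^ 2) (Metric.ball a (ρ / 2)) :=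
        integrableOn_ball_of_continuousOn
          (((H.2 a).1.continuousOn.mono hb2).norm.pow 2)
      have hint : ∫ w in Metric.ball a (ρ / 2), ‖g w‖ ^ 2
          ≤ 2 * J + 2 * (Real.pi * (n + 1) ^ 2 * J) := by
        have i1 : IntegrableOn (fun w => 2 * ‖f w‖ ^ 2) (Metric.ball a (ρ / 2)) :=
          (hfc.mono_set hsub).const_mul _
        calc ∫ w in Metric.ball a (ρ / 2), ‖g w‖ ^ 2
            ≤ ∫ w in Metric.ball a (ρ / 2),
                (2 * ‖f w‖ ^ 2 + 2 * ((n + 1) ^ 2 * J / (ρ / 2) ^ 2)) :=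
              setIntegral_mono_on hgc (i1.add (integrableOn_ball_of_continuousOn continuousOn_const)) measurableSet_ball hpt
          _ = 2 * (∫ w in Metric.ball a (ρ / 2), ‖f w‖ ^ 2)
                + 2 * (Real.pi * (n + 1) ^ 2 * J) := by
              rw [integral_add i1 (integrableOn_ball_of_continuousOn continuousOn_const),
                integral_const_mul, setIntegral_const,
                volume_real_ball a hρ2.le, smul_eq_mul]
              field_simp
          _ ≤ _ := by
              have : ∫ w in Metric.ball a (ρ / 2), ‖f w‖ ^ 2 ≤ J :=
                setIntegral_mono_set hfc (Eventually.of_forall fun _ => sq_nonneg _)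
                  hsub.eventuallyLE
              linarith
      rw [hga]
      have h5 : ‖g a‖ ^ 2 * (ρ / 2) ^ 2 ≤ C * (2 * J + 2 * (Real.pi * (n + 1) ^ 2 * J)) :=
        hg.trans (by gcongr)
      have h6 : 0 ≤ C * (1 + Real.pi * (n + 1) ^ 2) * J := by positivity
      nlinarith

/-! ### Completeness and point evaluations -/

theorem closedBall_subset_upperPlane {a : ℂ} {ρ : ℝ} (h : ρ < a.im) :
    Metric.closedBall a ρ ⊆ upperPlane := by
  intro w hw
  have h1 : |(w - a).im| ≤ ρ := (Complex.abs_im_le_norm _).trans (mem_closedBall_iff_norm.1 hw)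
  have h2 := (abs_le.1 h1).1
  rw [Complex.sub_im] at h2
  change 0 < w.im
  linarith

theorem IsLeadingCoeff.norm_le_of_forall_norm_le {n : ℕ} {f h : ℂ → ℂ} (H : IsLeadingCoeff n f h)
    {a : ℂ} {ρ : ℝ} (hρ : 0 < ρ) (hb : Metric.closedBall a ρ ⊆ upperPlane) {ε : ℝ} (hε : 0 ≤ ε)
    (hf : ∀ w ∈ Metric.closedBall a ρ, ‖f w‖ ≤ ε) : ‖h a‖ * ρ ^ n ≤ 2 * (n + 1) * ε := by
  have h1 := H.norm_sq_le hρ hb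
  have h2 : ∫ w in Metric.ball a ρ, ‖f w‖ ^ 2 ≤ ε ^ 2 * (Real.pi * ρ ^ 2) := by
    rw [← volume_real_ball a hρ.le, mul_comm, ← smul_eq_mul, ← setIntegral_const]
    refine setIntegral_mono_on (integrableOn_ball_of_continuousOn
      ((H.continuousOn.mono hb).norm.pow 2))
      (integrableOn_ball_of_continuousOn continuousOn_const) measurableSet_ball fun w hw => ?_
    exact pow_le_pow_left₀ (norm_nonneg _) (hf w (Metric.ball_subset_closedBall hw)) 2
  refine le_of_sq_le_sq ?_ (by positivity)
  have h3 : (‖h a‖ * ρ ^ n) ^ 2 * ρ ^ 2 ≤ ((n + 1) ^ 2 * ε ^ 2 * Real.pi) * ρ ^ 2 := by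
    calc (‖h a‖ * ρ ^ n) ^ 2 * ρ ^ 2 = ‖h a‖ ^ 2 * ρ ^ (2 * n + 2) := by ring
      _ ≤ (n + 1) ^ 2 * (ε ^ 2 * (Real.pi * ρ ^ 2)) := h1.trans (by gcongr)
      _ = _ := by ring
  have h4 := le_of_mul_le_mul_right h3 (by positivity)
  have h5 : 0 ≤ ((n : ℝ) + 1) ^ 2 * ε ^ 2 := by positivity
  nlinarith [Real.pi_le_four]

/-- A locally uniformly Cauchy sequence of `n`-polyanalytic functions has an `n`-polyanalytic limit:
the leading coefficients form a locally uniformly Cauchy sequence of holomorphic functions, and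
removing the leading terms lowers the order. -/
theorem exists_isPolyanalytic_limit (n : ℕ) (f : ℕ → ℂ → ℂ) (hf : ∀ m, IsPolyanalytic n (f m))
    (hc : ∀ K ⊆ upperPlane, IsCompact K → UniformCauchySeqOn f atTop K) :
    ∃ g, IsPolyanalytic n g ∧ ∀ z ∈ upperPlane, Tendsto (fun m => f m z) atTop (𝓝 (g z)) := by
  induction n generalizing f with
  | zero =>
    refine ⟨0, isPolyanalytic_zero 0, fun z hz => ?_⟩
    have : ∀ m, f m z = 0 := fun m => (hf m).2 z hz
    simp [this]
  | succ n ih =>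
    choose h H using fun m => (hf m).exists_leadingCoeff
    have hcoef : ∀ K ⊆ upperPlane, IsCompact K → UniformCauchySeqOn h atTop K := by
      intro K hK hKc
      obtain ⟨δ, hδ, hδK⟩ := hKc.exists_cthickening_subset_open isOpen_upperPlane hK
      have hK' := Metric.uniformCauchySeqOn_iff.1 (hc _ hδK hKc.cthickening)
      refine Metric.uniformCauchySeqOn_iff.2 fun ε hε => ?_
      obtain ⟨N, hN⟩ := hK' (ε * δ ^ n / (4 * (n + 1))) (by positivity)
      refine ⟨N, fun m hm l hl a ha => ?_⟩
      have hba := Metric.closedBall_subset_cthickening ha δ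
      have h1 := ((H m).sub (H l)).norm_le_of_forall_norm_le hδ (hba.trans hδK)
        (ε := ε * δ ^ n / (4 * (n + 1))) (by positivity) fun w hw => by
          have := (hN m hm l hl w (hba hw)).le
          rwa [dist_eq_norm] at this
      have h2 : 2 * ((n : ℝ) + 1) * (ε * δ ^ n / (4 * (n + 1))) = ε / 2 * δ ^ n := by
        field_simp; norm_num
      rw [h2] at h1
      have h3 := le_of_mul_le_mul_right h1 (by positivity)
      rw [dist_eq_norm]
      simp only [Pi.sub_apply] at h3
      linarith
    have hlim : ∀ z ∈ upperPlane, ∃ y, Tendsto (fun m => h m z) atTop (𝓝 y) := fun z hz =>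
      cauchySeq_tendsto_of_complete
        ((hcoef {z} (by simpa using hz) isCompact_singleton).cauchySeq rfl)
    choose! k hk using hlim
    have hkd : DifferentiableOn ℂ k upperPlane := by
      refine TendstoLocallyUniformlyOn.differentiableOn (F := h) (φ := atTop) ?_
        (Eventually.of_forall fun m => (H m).1) isOpen_upperPlane
      refine (tendstoLocallyUniformlyOn_iff_forall_isCompact isOpen_upperPlane).2 fun K hK hKc => ?_
      exact (hcoef K hK hKc).tendstoUniformlyOn_of_tendsto fun z hz => hk z (hK hz)
    obtain ⟨g, hg, hg'⟩ := ih (fun m z => f m z - conj (z - 0) ^ n * h m z) (fun m => (H m).2 0) <| by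
      intro K hK hKc
      obtain ⟨M, hM⟩ := hKc.exists_bound_of_continuousOn (continuous_conj_sub_pow 0 n).continuousOn
      refine Metric.uniformCauchySeqOn_iff.2 fun ε hε => ?_
      obtain ⟨N₁, h1⟩ := Metric.uniformCauchySeqOn_iff.1 (hc K hK hKc) (ε / 2) (by positivity)
      obtain ⟨N₂, h2⟩ := Metric.uniformCauchySeqOn_iff.1 (hcoef K hK hKc)
        (ε / (2 * (|M| + 1))) (by positivity)
      refine ⟨max N₁ N₂, fun m hm l hl z hz => ?_⟩
      have e1 := h1 m (le_of_max_le_left hm) l (le_of_max_le_left hl) z hz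
      have e2 := h2 m (le_of_max_le_right hm) l (le_of_max_le_right hl) z hz
      rw [dist_eq_norm] at e1 e2 ⊢
      have e3 : ‖conj (z - 0) ^ n * (h m z - h l z)‖ ≤ (|M| + 1) * (ε / (2 * (|M| + 1))) := by
        rw [norm_mul]
        gcongr
        exact (hM z hz).trans ((le_abs_self M).trans (by linarith))
      have e4 : (|M| + 1) * (ε / (2 * (|M| + 1))) = ε / 2 := by field_simp
      calc ‖f m z - conj (z - 0) ^ n * h m z - (f l z - conj (z - 0) ^ n * h l z)‖
          = ‖(f m z - f l z) - conj (z - 0) ^ n * (h m z - h l z)‖ := by congr 1; ring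
        _ ≤ ‖f m z - f l z‖ + ‖conj (z - 0) ^ n * (h m z - h l z)‖ := norm_sub_le _ _
        _ < ε := by linarith
    refine ⟨_, hg.succ.add (isPolyanalytic_conj_sub_pow_mul 0 n hkd), fun z hz => ?_⟩
    have := (hg' z hz).add ((hk z hz).const_mul (conj (z - 0) ^ n))
    simpa only [sub_add_cancel, Pi.add_apply] using this

theorem norm_sq_eq_integral {α : Type*} [MeasurableSpace α] {ν : Measure α} (u : Lp ℂ 2 ν) :
    ‖u‖ ^ 2 = ∫ z, ‖u z‖ ^ 2 ∂ν := by
  have h := L2.inner_def (𝕜 := ℂ) u u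
  simp_rw [inner_self_eq_norm_sq_to_K] at h
  have h2 : ∫ z, ((‖u z‖ : ℂ)) ^ 2 ∂ν = ((∫ z, ‖u z‖ ^ 2 ∂ν : ℝ) : ℂ) := by
    exact_mod_cast integral_ofReal (𝕜 := ℂ) (μ := ν) (f := fun z => ‖u z‖ ^ (2 : ℕ))
  have h3 : ((‖u‖ ^ 2 : ℝ) : ℂ) = ((∫ z, ‖u z‖ ^ 2 ∂ν : ℝ) : ℂ) := by
    rw [← h2]; push_cast; exact h
  exact_mod_cast h3

theorem norm_sq_eq_integral_of_ae_eq {u : Lp ℂ 2 area} {f : ℂ → ℂ} (h : u =ᵐ[area] f) :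
    ‖u‖ ^ 2 = ∫ z, ‖f z‖ ^ 2 ∂area := by
  rw [norm_sq_eq_integral]
  exact integral_congr_ae (h.mono fun z hz => by simp only [hz])

theorem integrable_norm_sq_of_ae_eq {u : Lp ℂ 2 area} {f : ℂ → ℂ} (h : u =ᵐ[area] f) :
    Integrable (fun z => ‖f z‖ ^ 2) area :=
  (((memLp_congr_ae h).1 (Lp.memLp u)).integrable_norm_pow two_ne_zero)

/-- Point evaluations are bounded on the poly-Bergman space. -/
theorem exists_norm_mul_im_le (n : ℕ) : ∃ C : ℝ, 0 < C ∧ ∀ (u : Lp ℂ 2 area) (f : ℂ → ℂ),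
    IsPolyanalytic n f → u =ᵐ[area] f → ∀ z ∈ upperPlane, ‖f z‖ * z.im ≤ C * ‖u‖ := by
  obtain ⟨C, hC, h⟩ := exists_norm_sq_le_setIntegral_ball n
  refine ⟨2 * √C, by positivity, fun u f hf hu z hz => ?_⟩
  have hz' : 0 < z.im := hz
  have hb : Metric.closedBall z (z.im / 2) ⊆ upperPlane :=
    closedBall_subset_upperPlane (by linarith)
  have h1 := h f hf z (z.im / 2) (by positivity) hb
  have h2 : ∫ w in Metric.ball z (z.im / 2), ‖f w‖ ^ 2 ≤ ‖u‖ ^ 2 := by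
    rw [norm_sq_eq_integral_of_ae_eq hu]
    exact setIntegral_mono_set (integrable_norm_sq_of_ae_eq hu)
      (Eventually.of_forall fun _ => sq_nonneg _)
      (Metric.ball_subset_closedBall.trans hb).eventuallyLE
  refine le_of_sq_le_sq ?_ (by positivity)
  calc (‖f z‖ * z.im) ^ 2 = 4 * (‖f z‖ ^ 2 * (z.im / 2) ^ 2) := by ring
    _ ≤ 4 * (C * ‖u‖ ^ 2) := by exact mul_le_mul_of_nonneg_left (h1.trans (by gcongr)) (by norm_num)
    _ = (2 * √C * ‖u‖) ^ 2 := by rw [mul_pow, mul_pow, Real.sq_sqrt hC.le]; ring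

theorem ae_area_mem_upperPlane : ∀ᵐ z ∂area, z ∈ upperPlane :=
  ae_restrict_mem isOpen_upperPlane.measurableSet

theorem exists_seq_tendsto_ae_of_tendsto_Lp {α : Type*} [MeasurableSpace α] {ν : Measure α}
    {x : ℕ → Lp ℂ 2 ν} {u : Lp ℂ 2 ν} (h : Tendsto x atTop (𝓝 u)) :
    ∃ ns : ℕ → ℕ, StrictMono ns ∧ ∀ᵐ z ∂ν, Tendsto (fun i => x (ns i) z) atTop (𝓝 (u z)) :=
  (tendstoInMeasure_of_tendsto_Lp h).exists_seq_tendsto_ae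

theorem isClosed_polyBergman (n : ℕ) : IsClosed (polyBergman n : Set (Lp ℂ 2 area)) := by
  refine IsSeqClosed.isClosed fun x u hx hu => ?_
  choose f hf hxf using hx
  obtain ⟨C, hC, hbd⟩ := exists_norm_mul_im_le n
  have hcau : ∀ K ⊆ upperPlane, IsCompact K → UniformCauchySeqOn f atTop K := by
    intro K hK hKc
    obtain ⟨c, hc, hcK⟩ := hKc.exists_forall_le' Complex.continuous_im.continuousOn hK
    refine Metric.uniformCauchySeqOn_iff.2 fun ε hε => ?_
    obtain ⟨N, hN⟩ := Metric.cauchySeq_iff.1 hu.cauchySeq (ε * c / C) (by positivity)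
    refine ⟨N, fun m hm l hl z hz => ?_⟩
    have h1 := hbd (x m - x l) (f m - f l) ((hf m).sub (hf l))
      ((Lp.coeFn_sub _ _).trans ((hxf m).sub (hxf l))) z (hK hz)
    have h2 := hN m hm l hl
    rw [dist_eq_norm] at h2 ⊢
    have h3 : ‖f m z - f l z‖ * c < ε * c :=
      calc ‖f m z - f l z‖ * c ≤ ‖f m z - f l z‖ * z.im := by gcongr; exact hcK z hz
        _ ≤ C * ‖x m - x l‖ := h1
        _ < C * (ε * c / C) := by gcongr
        _ = ε * c := by field_simp
    exact lt_of_mul_lt_mul_right h3 hc.le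
  obtain ⟨g, hg, hlim⟩ := exists_isPolyanalytic_limit n f hf hcau
  refine ⟨g, hg, ?_⟩
  obtain ⟨ns, hns, hae⟩ := exists_seq_tendsto_ae_of_tendsto_Lp hu
  filter_upwards [hae, ae_all_iff.2 hxf, ae_area_mem_upperPlane] with z h1 h2 hz
  refine tendsto_nhds_unique h1 ?_
  simp_rw [h2]
  exact (hlim z hz).comp hns.tendsto_atTop

instance completeSpace_trueBergman (n : ℕ) : CompleteSpace (trueBergman n) :=
  ((isClosed_polyBergman n).inter (Submodule.isClosed_orthogonal _)).completeSpace_coe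

theorem smoothRep_continuousOn {n : ℕ} (u : trueBergman n) : ContinuousOn (smoothRep u) upperPlane :=
  (smoothRep_spec u).1.1.continuousOn

theorem smoothRep_add {n : ℕ} (u v : trueBergman n) :
    Set.EqOn (smoothRep (u + v)) (smoothRep u + smoothRep v) upperPlane :=
  smoothRep_eqOn _ ((smoothRep_continuousOn u).add (smoothRep_continuousOn v))
    ((Lp.coeFn_add _ _).trans ((smoothRep_spec u).2.add (smoothRep_spec v).2))

theorem smoothRep_smul {n : ℕ} (c : ℂ) (u : trueBergman n) :
    Set.EqOn (smoothRep (c • u)) (c • smoothRep u) upperPlane :=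
  smoothRep_eqOn _ ((smoothRep_continuousOn u).const_smul c)
    ((Lp.coeFn_smul _ _).trans ((smoothRep_spec u).2.const_smul c))

theorem exists_norm_smoothRep_mul_im_le (n : ℕ) : ∃ C : ℝ, 0 < C ∧ ∀ u : trueBergman n,
    ∀ z ∈ upperPlane, ‖smoothRep u z‖ * z.im ≤ C * ‖u‖ := by
  obtain ⟨C, hC, h⟩ := exists_norm_mul_im_le n
  exact ⟨C, hC, fun u => h u _ (smoothRep_spec u).1 (smoothRep_spec u).2⟩

/-- Evaluation of the smooth representative at a point of `Π`. -/
def evalCLM (n : ℕ) {z : ℂ} (hz : z ∈ upperPlane) : trueBergman n →L[ℂ] ℂ :=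
  LinearMap.mkContinuousOfExistsBound
    { toFun := fun u => smoothRep u z
      map_add' := fun u v => smoothRep_add u v hz
      map_smul' := fun c u => smoothRep_smul c u hz } <| by
    obtain ⟨C, hC, h⟩ := exists_norm_smoothRep_mul_im_le n
    refine ⟨C / z.im, fun u => ?_⟩
    have hz' : 0 < z.im := hz
    rw [div_mul_eq_mul_div, le_div_iff₀ hz']
    exact h u z hz

/-! ### Embeddings into `L²(|μ|)` -/

open scoped ENNReal

namespace PlaneMeasure

variable (μ : PlaneMeasure)

theorem ae_mem_upperPlane : ∀ᵐ z ∂μ.variation, z ∈ upperPlane := μ.concentrated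

theorem restrict_upperPlane : μ.variation.restrict upperPlane = μ.variation :=
  Measure.restrict_eq_self_of_ae_mem μ.ae_mem_upperPlane

theorem aestronglyMeasurable_of_continuousOn {f : ℂ → ℂ} (hf : ContinuousOn f upperPlane) :
    AEStronglyMeasurable f μ.variation := by
  rw [← μ.restrict_upperPlane]
  exact hf.aestronglyMeasurable isOpen_upperPlane.measurableSet

@[simp]
theorem ypow_zero_variation : (μ.ypow 0).variation = μ.variation := by
  simp [ypow]

end PlaneMeasure

/-- The compact sets `{|z| ≤ n, Im z ≥ 1 / (n + 1)}`, which exhaust `Π`. -/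
def exhaustion (n : ℕ) : Set ℂ := {z | 1 / ((n : ℝ) + 1) ≤ z.im} ∩ Metric.closedBall 0 n

theorem exhaustion_subset (n : ℕ) : exhaustion n ⊆ upperPlane := fun z hz =>
  lt_of_lt_of_le (by positivity : (0 : ℝ) < 1 / ((n : ℝ) + 1)) hz.1

theorem isCompact_exhaustion (n : ℕ) : IsCompact (exhaustion n) :=
  (isCompact_closedBall (0 : ℂ) n).inter_left
    (isClosed_le continuous_const Complex.continuous_im)

theorem exists_mem_exhaustion {z : ℂ} (hz : z ∈ upperPlane) : ∃ n, z ∈ exhaustion n := by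
  have hz' : 0 < z.im := hz
  obtain ⟨n, hn⟩ := exists_nat_ge (max ‖z‖ (1 / z.im))
  refine ⟨n, ?_, by simpa using (le_max_left _ _).trans hn⟩
  have h1 : 1 / z.im ≤ (n : ℝ) + 1 := ((le_max_right _ _).trans hn).trans (by linarith)
  change 1 / ((n : ℝ) + 1) ≤ z.im
  rw [div_le_iff₀ hz'] at h1
  rw [div_le_iff₀ (by positivity)]
  linarith

instance PlaneMeasure.sigmaFinite_variation (μ : PlaneMeasure) : SigmaFinite μ.variation := by
  refine ⟨⟨⟨fun n => exhaustion n ∪ upperPlaneᶜ, fun _ => trivial, fun n => ?_, ?_⟩⟩⟩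
  · refine (measure_union_le _ _).trans_lt ?_
    rw [μ.concentrated, add_zero]
    exact μ.finite_on_compacts _ (exhaustion_subset n) (isCompact_exhaustion n)
  · refine Set.eq_univ_of_forall fun z => ?_
    by_cases hz : z ∈ upperPlane
    · obtain ⟨n, hn⟩ := exists_mem_exhaustion hz
      exact Set.mem_iUnion.2 ⟨n, Or.inl hn⟩
    · exact Set.mem_iUnion.2 ⟨0, Or.inr hz⟩

/-- The embedding `A_(n) → L²(|μ|)`, defined as soon as `A_(n) ⊆ L²(|μ|)`; it is bounded by the
closed graph theorem, since convergence in `A_(n)` implies pointwise convergence. -/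
def embedding {n : ℕ} (μ : PlaneMeasure)
    (hμ : ∀ u : trueBergman n, MemLp (smoothRep u) 2 μ.variation) :
    trueBergman n →L[ℂ] Lp ℂ 2 μ.variation :=
  ContinuousLinearMap.ofSeqClosedGraph
    (g := { toFun := fun u => (hμ u).toLp
            map_add' := fun u v => by
              rw [← MemLp.toLp_add]
              exact MemLp.toLp_congr _ _
                (μ.ae_mem_upperPlane.mono fun z hz => smoothRep_add u v hz)
            map_smul' := fun c u => by
              rw [RingHom.id_apply, ← MemLp.toLp_const_smul]
              exact MemLp.toLp_congr _ _
                (μ.ae_mem_upperPlane.mono fun z hz => smoothRep_smul c u hz) }) <| by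
    intro u x y hu hy
    obtain ⟨ns, hns, hae⟩ := exists_seq_tendsto_ae_of_tendsto_Lp hy
    refine Lp.ext ?_
    filter_upwards [hae, μ.ae_mem_upperPlane, ae_all_iff.2 fun k => (hμ (u k)).coeFn_toLp,
      (hμ x).coeFn_toLp] with z h1 hz h2 h3
    refine (tendsto_nhds_unique h1 ?_).trans h3.symm
    refine ((((evalCLM n hz).continuous.tendsto x).comp hu).comp hns.tendsto_atTop).congr ?_
    intro k
    exact (h2 (ns k)).symm

theorem coeFn_embedding {n : ℕ} (μ : PlaneMeasure)
    (hμ : ∀ u : trueBergman n, MemLp (smoothRep u) 2 μ.variation) (u : trueBergman n) :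
    embedding μ hμ u =ᵐ[μ.variation] smoothRep u :=
  (hμ u).coeFn_toLp

theorem enorm_sq_eq_lintegral {α : Type*} [MeasurableSpace α] {ν : Measure α} (u : Lp ℂ 2 ν) :
    ‖u‖ₑ ^ 2 = ∫⁻ z, ‖u z‖ₑ ^ 2 ∂ν := by
  rw [Lp.enorm_def, eLpNorm_eq_lintegral_rpow_enorm_toReal (by simp) (by simp)]
  simp only [ENNReal.toReal_ofNat, ENNReal.rpow_ofNat]
  rw [← ENNReal.rpow_natCast, ← ENNReal.rpow_mul]
  simp

theorem enorm_embedding_sq {n : ℕ} (μ : PlaneMeasure)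
    (hμ : ∀ u : trueBergman n, MemLp (smoothRep u) 2 μ.variation) (u : trueBergman n) :
    ‖embedding μ hμ u‖ₑ ^ 2 = ∫⁻ z, ‖smoothRep u z‖ₑ ^ 2 ∂μ.variation := by
  rw [enorm_sq_eq_lintegral]
  exact lintegral_congr_ae ((coeFn_embedding μ hμ u).mono fun z hz => by simp only [hz])

theorem enorm_sq_eq_lintegral_smoothRep {n : ℕ} (u : trueBergman n) :
    ‖u‖ₑ ^ 2 = ∫⁻ z, ‖smoothRep u z‖ₑ ^ 2 ∂area := by
  have : ‖u‖ₑ = ‖(u : Lp ℂ 2 area)‖ₑ := rfl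
  rw [this, enorm_sq_eq_lintegral]
  exact lintegral_congr_ae ((smoothRep_spec u).2.mono fun z hz => by simp only [hz])

theorem memLp_smoothRep_area {n : ℕ} (u : trueBergman n) : MemLp (smoothRep u) 2 area :=
  (memLp_congr_ae (smoothRep_spec u).2).1 (Lp.memLp _)

theorem isBergman_smoothRep (u : trueBergman 1) : IsBergman (smoothRep u) :=
  ⟨(smoothRep_spec u).1, memLp_smoothRep_area u⟩

theorem IsBergman.exists_smoothRep_eqOn {f : ℂ → ℂ} (hf : IsBergman f) :
    ∃ u : trueBergman 1, Set.EqOn (smoothRep u) f upperPlane := by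
  have h : hf.2.toLp ∈ trueBergman 1 := by
    rw [trueBergman_one]
    exact ⟨f, hf.1, hf.2.coeFn_toLp⟩
  exact ⟨⟨_, h⟩, smoothRep_eqOn _ hf.1.1.continuousOn hf.2.coeFn_toLp⟩

/-- The absolute convergence required of a Carleson measure alone gives a uniform bound for the
variation. -/
theorem IsKCarleson.exists_lintegral_le {μ : PlaneMeasure} (h : IsKCarleson 0 (μ.ypow 0)) :
    ∃ C : ℝ≥0∞, C ≠ ⊤ ∧ ∀ f, IsBergman f →
      ∫⁻ z, ‖f z‖ₑ ^ 2 ∂μ.variation ≤ C * ∫⁻ z, ‖f z‖ₑ ^ 2 ∂area := by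
  obtain ⟨_, _, h⟩ := h
  have hμ : ∀ u : trueBergman 1, MemLp (smoothRep u) 2 μ.variation := fun u => by
    have := (h _ (isBergman_smoothRep u)).1
    rw [μ.ypow_zero_variation, iteratedDeriv_zero] at this
    exact (memLp_two_iff_integrable_sq_norm
      (μ.aestronglyMeasurable_of_continuousOn (smoothRep_continuousOn u))).2 this
  refine ⟨‖embedding μ hμ‖ₑ ^ 2, by simp, fun f hf => ?_⟩
  obtain ⟨u, hu⟩ := hf.exists_smoothRep_eqOn
  have h1 : ∫⁻ z, ‖f z‖ₑ ^ 2 ∂μ.variation = ‖embedding μ hμ u‖ₑ ^ 2 := by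
    rw [enorm_embedding_sq]
    exact lintegral_congr_ae (μ.ae_mem_upperPlane.mono fun z hz => by simp only [hu hz])
  have h2 : ∫⁻ z, ‖f z‖ₑ ^ 2 ∂area = ‖u‖ₑ ^ 2 := by
    rw [enorm_sq_eq_lintegral_smoothRep]
    exact lintegral_congr_ae (ae_area_mem_upperPlane.mono fun z hz => by simp only [hu hz])
  rw [h1, h2, ← mul_pow]
  gcongr
  exact (embedding μ hμ).le_opENorm u

/-! ### Test functions in the Bergman space -/

/-- The normalized reproducing kernel of the Bergman space at `w`, up to a constant factor. -/
def bergmanTest (w z : ℂ) : ℂ := w.im / (z - conj w) ^ 2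

theorem sq_norm_sub_conj {w z : ℂ} :
    ‖z - conj w‖ ^ 2 = (z.re - w.re) ^ 2 + (z.im + w.im) ^ 2 := by
  rw [← Complex.normSq_eq_norm_sq, Complex.normSq_apply]
  simp
  ring

theorem im_add_im_le_norm_sub_conj (w z : ℂ) : z.im + w.im ≤ ‖z - conj w‖ := by
  have := Complex.abs_im_le_norm (z - conj w)
  simp at this
  exact (le_abs_self _).trans this

theorem norm_bergmanTest {w z : ℂ} (hw : w ∈ upperPlane) :
    ‖bergmanTest w z‖ = w.im / ‖z - conj w‖ ^ 2 := by
  have hw' : 0 < w.im := hw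
  rw [bergmanTest, norm_div, norm_pow, Complex.norm_real, Real.norm_of_nonneg hw'.le]

theorem integrable_inv_one_add_norm_sq_sq :
    Integrable fun z : ℂ => ((1 + ‖z‖ ^ 2) ^ 2)⁻¹ := by
  have h := integrable_rpow_neg_one_add_norm_sq (E := ℂ) (μ := volume) (r := 4)
    (by rw [Complex.finrank_real_complex]; norm_num)
  refine h.congr (Eventually.of_forall fun z => ?_)
  have : (-4 / 2 : ℝ) = -((2 : ℕ) : ℝ) := by norm_num
  simp only [this]
  rw [Real.rpow_neg (by positivity), Real.rpow_natCast]

/-- With `ζ = (z - Re w) / Im w`, the square of the test function is at most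
`(Im w)⁻² (1 + |ζ|²)⁻²`, whose integral does not depend on `w`. -/
theorem exists_bergmanTest_bound : ∃ C : ℝ, 0 ≤ C ∧ ∀ w ∈ upperPlane,
    IsBergman (bergmanTest w) ∧ ∫ z, ‖bergmanTest w z‖ ^ 2 ∂area ≤ C := by
  set g : ℂ → ℝ := fun z => ((1 + ‖z‖ ^ 2) ^ 2)⁻¹ with hg
  have hgi : Integrable g := integrable_inv_one_add_norm_sq_sq
  refine ⟨∫ z, g z, integral_nonneg fun z => by positivity, fun w hw => ?_⟩
  have hw' : 0 < w.im := hw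
  set G : ℂ → ℝ := fun z => (w.im ^ 2)⁻¹ * g (w.im⁻¹ • (z - w.re)) with hG
  have hGi : Integrable G :=
    ((hgi.comp_smul (inv_ne_zero hw'.ne')).comp_sub_right (w.re : ℂ)).const_mul _
  have hGint : ∫ z, G z = ∫ z, g z := by
    simp only [hG]
    rw [integral_const_mul, integral_sub_right_eq_self (fun z => g (w.im⁻¹ • z)) (w.re : ℂ),
      Measure.integral_comp_inv_smul_of_nonneg _ _ hw'.le, Complex.finrank_real_complex,
      smul_eq_mul, inv_mul_cancel_left₀ (by positivity)]
  have hbd : ∀ z ∈ upperPlane, ‖bergmanTest w z‖ ^ 2 ≤ G z := by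
    intro z hz
    have hz' : 0 < z.im := hz
    rw [norm_bergmanTest hw, hG, hg]
    have h1 : w.im ^ 2 * (1 + ‖w.im⁻¹ • (z - w.re)‖ ^ 2) ≤ ‖z - conj w‖ ^ 2 := by
      rw [sq_norm_sub_conj, norm_smul, mul_pow, norm_inv, Real.norm_of_nonneg hw'.le, inv_pow,
        mul_add, mul_inv_cancel_left₀ (by positivity), ← Complex.normSq_eq_norm_sq,
        Complex.normSq_apply]
      simp
      nlinarith
    calc (w.im / ‖z - conj w‖ ^ 2) ^ 2
        ≤ (w.im / (w.im ^ 2 * (1 + ‖w.im⁻¹ • (z - w.re)‖ ^ 2))) ^ 2 := by gcongr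
      _ = (w.im ^ 2)⁻¹ * ((1 + ‖w.im⁻¹ • (z - w.re)‖ ^ 2) ^ 2)⁻¹ := by
          field_simp
  have hd : DifferentiableOn ℂ (bergmanTest w) upperPlane := by
    intro z hz
    have hz' : 0 < z.im := hz
    have h0 : (z - conj w) ^ 2 ≠ 0 := by
      refine pow_ne_zero _ (norm_pos_iff.1 ?_)
      exact lt_of_lt_of_le (by linarith) (im_add_im_le_norm_sub_conj w z)
    have h1 : DifferentiableAt ℂ (fun z => (z - conj w) ^ 2) z := by fun_prop
    exact ((differentiableAt_const (w.im : ℂ)).div h1 h0).differentiableWithinAt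
  have hm : AEStronglyMeasurable (bergmanTest w) area :=
    hd.continuousOn.aestronglyMeasurable isOpen_upperPlane.measurableSet
  have hae : ∀ᵐ z ∂area, ‖bergmanTest w z‖ ^ 2 ≤ G z := ae_area_mem_upperPlane.mono hbd
  have hi : Integrable (fun z => ‖bergmanTest w z‖ ^ 2) area :=
    hGi.integrableOn.mono' (hm.norm.pow 2) (hae.mono fun z hz => by simpa using hz)
  refine ⟨⟨(isPolyanalytic_one_iff _).2 hd, (memLp_two_iff_integrable_sq_norm hm).2 hi⟩, ?_⟩
  rw [← hGint]
  refine (integral_mono_ae hi hGi.integrableOn hae).trans ?_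
  exact setIntegral_le_integral hGi (Eventually.of_forall fun z => by simp only [hG, hg]; positivity)

/-! ### The density of a Carleson measure -/

/-- The ratio of the `|μ|`-mass of the disc `|z - w| < Im w / 3` to `(Im w)²`. -/
def PlaneMeasure.density (μ : PlaneMeasure) (w : ℂ) : ℝ≥0∞ :=
  μ.variation (Metric.ball w (w.im / 3)) / ENNReal.ofReal (w.im ^ 2)

/-- On the disc `|z - w| < Im w / 3` one has `|z - conj w| ≤ 3 Im w`, so that the test function has
modulus at least `1 / (9 Im w)` there. -/
theorem PlaneMeasure.density_le_lintegral (μ : PlaneMeasure) {w : ℂ} (hw : w ∈ upperPlane) :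
    μ.density w ≤ 81 * ∫⁻ z, ‖bergmanTest w z‖ₑ ^ 2 ∂μ.variation := by
  have hw' : 0 < w.im := hw
  have hpt : ∀ z ∈ Metric.ball w (w.im / 3),
      (ENNReal.ofReal (w.im ^ 2))⁻¹ ≤ 81 * ‖bergmanTest w z‖ₑ ^ 2 := by
    intro z hz
    have h1 : ‖z - w‖ < w.im / 3 := mem_ball_iff_norm.1 hz
    have h2 : ‖w - conj w‖ = 2 * w.im := by
      rw [Complex.sub_conj, norm_mul, Complex.norm_I, mul_one, Complex.norm_real,
        Real.norm_of_nonneg (by positivity)]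
    have h3 : ‖z - conj w‖ ≤ 3 * w.im := by
      calc ‖z - conj w‖ = ‖(z - w) + (w - conj w)‖ := by congr 1; ring
        _ ≤ ‖z - w‖ + ‖w - conj w‖ := norm_add_le _ _
        _ ≤ 3 * w.im := by rw [h2]; linarith
    have h4 : 0 < ‖z - conj w‖ := by
      refine lt_of_lt_of_le ?_ (im_add_im_le_norm_sub_conj w z)
      have : z ∈ upperPlane :=
        closedBall_subset_upperPlane (by linarith) (Metric.ball_subset_closedBall hz)
      have : 0 < z.im := this
      linarith
    have h5 : (w.im ^ 2)⁻¹ ≤ 81 * ‖bergmanTest w z‖ ^ 2 := by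
      rw [norm_bergmanTest hw]
      calc (w.im ^ 2)⁻¹ = 81 * (w.im / (3 * w.im) ^ 2) ^ 2 := by field_simp; norm_num
        _ ≤ 81 * (w.im / ‖z - conj w‖ ^ 2) ^ 2 := by gcongr
    rw [← ENNReal.ofReal_inv_of_pos (by positivity), ← ofReal_norm,
      ← ENNReal.ofReal_pow (norm_nonneg _)]
    refine (ENNReal.ofReal_le_ofReal h5).trans_eq ?_
    rw [ENNReal.ofReal_mul (by norm_num), ENNReal.ofReal_ofNat]
  rw [PlaneMeasure.density, div_eq_mul_inv, mul_comm, ← setLIntegral_const,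
    ← lintegral_const_mul' _ _ (by norm_num)]
  exact (setLIntegral_mono' measurableSet_ball hpt).trans (setLIntegral_le_lintegral _ _)

theorem lintegral_enorm_sq_le_of_integral_le {f : ℂ → ℂ} (hf : IsBergman f) {C : ℝ}
    (h : ∫ z, ‖f z‖ ^ 2 ∂area ≤ C) : ∫⁻ z, ‖f z‖ₑ ^ 2 ∂area ≤ ENNReal.ofReal C := by
  have hi := hf.2.integrable_norm_pow two_ne_zero
  have := ofReal_integral_eq_lintegral_ofReal hi (Eventually.of_forall fun _ => by positivity)
  refine le_trans (le_of_eq ?_) (this.symm.trans_le (ENNReal.ofReal_le_ofReal h))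
  refine lintegral_congr fun z => ?_
  rw [ENNReal.ofReal_pow (norm_nonneg _), ofReal_norm]

/-- Carleson measures have bounded density. -/
theorem IsKCarleson.exists_density_le {μ : PlaneMeasure} (h : IsKCarleson 0 (μ.ypow 0)) :
    ∃ C : ℝ≥0∞, C ≠ ⊤ ∧ ∀ w ∈ upperPlane, μ.density w ≤ C := by
  obtain ⟨C, hC, h⟩ := h.exists_lintegral_le
  obtain ⟨D, hD, hw⟩ := exists_bergmanTest_bound
  refine ⟨81 * (C * ENNReal.ofReal D), by finiteness, fun w hw' => ?_⟩
  obtain ⟨h1, h2⟩ := hw w hw'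
  refine (μ.density_le_lintegral hw').trans ?_
  gcongr
  refine (h _ h1).trans ?_
  gcongr
  exact lintegral_enorm_sq_le_of_integral_le h1 h2

/-- The test functions `bergmanTest w` tend to `0` locally uniformly as `w` leaves every compact
subset of `Π`. -/
theorem tendstoLocallyUniformlyOn_bergmanTest {w : ℕ → ℂ} (hw : ∀ n, w n ∈ upperPlane)
    (hw' : ∀ n, w n ∉ exhaustion n) :
    TendstoLocallyUniformlyOn (fun n => bergmanTest (w n)) (fun _ => 0) atTop upperPlane := by
  refine (tendstoLocallyUniformlyOn_iff_forall_isCompact isOpen_upperPlane).2 fun K hK hKc => ?_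
  obtain ⟨c, hc, hcK⟩ := hKc.exists_forall_le' Complex.continuous_im.continuousOn hK
  obtain ⟨R, hR⟩ := hKc.isBounded.exists_norm_le
  have hlim : Tendsto (fun n : ℕ => 1 / ((n : ℝ) + 1) / c ^ 2 + 1 / ((n : ℝ) - R)) atTop (𝓝 0) := by
    have h1 : Tendsto (fun n : ℕ => 1 / ((n : ℝ) + 1) / c ^ 2) atTop (𝓝 (0 / c ^ 2)) :=
      tendsto_one_div_add_atTop_nhds_zero_nat.div_const _
    have h2 : Tendsto (fun n : ℕ => 1 / ((n : ℝ) - R)) atTop (𝓝 0) := by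
      simp only [one_div]
      exact tendsto_inv_atTop_zero.comp
        (tendsto_atTop_add_const_right _ (-R) tendsto_natCast_atTop_atTop)
    simpa using h1.add h2
  refine Metric.tendstoUniformlyOn_iff.2 fun ε hε => ?_
  filter_upwards [hlim.eventually_lt_const hε,
    (tendsto_natCast_atTop_atTop (R := ℝ)).eventually_gt_atTop R] with n hn hnR z hz
  refine lt_of_le_of_lt ?_ hn
  have hw0 : 0 < (w n).im := hw n
  have hz0 : 0 < z.im := hK hz
  have hzc : c ≤ z.im := hcK z hz
  have h1 := im_add_im_le_norm_sub_conj (w n) z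
  have hp1 : 0 ≤ 1 / ((n : ℝ) + 1) / c ^ 2 := by positivity
  have hp2 : 0 ≤ 1 / ((n : ℝ) - R) := one_div_nonneg.2 (by linarith)
  rw [dist_zero_left, norm_bergmanTest (hw n)]
  by_cases hcase : 1 / ((n : ℝ) + 1) ≤ (w n).im
  · have h2 : (n : ℝ) < ‖w n‖ := by
      by_contra hcon
      exact hw' n ⟨hcase, by simpa using not_lt.1 hcon⟩
    have h3 : (n : ℝ) - R ≤ ‖z - conj (w n)‖ := by
      have h4 : ‖conj (w n)‖ - ‖z‖ ≤ ‖z - conj (w n)‖ := by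
        rw [norm_sub_rev]; exact norm_sub_norm_le _ _
      rw [RCLike.norm_conj] at h4
      linarith [hR z hz]
    have h5 : (w n).im / ‖z - conj (w n)‖ ^ 2 ≤ 1 / ((n : ℝ) - R) := by
      have h6 : 0 < ‖z - conj (w n)‖ := lt_of_lt_of_le (by linarith) h1
      rw [div_le_div_iff₀ (by positivity) (by linarith), one_mul, sq]
      exact mul_le_mul (by linarith) h3 (by linarith) (norm_nonneg _)
    linarith
  · have h5 : (w n).im / ‖z - conj (w n)‖ ^ 2 ≤ 1 / ((n : ℝ) + 1) / c ^ 2 := by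
      gcongr
      · exact (not_le.1 hcase).le
      · linarith
    linarith

/-- The density of a vanishing Carleson measure tends to `0` at the boundary of `Π`. -/
theorem IsVanishingKCarleson.exists_density_le {μ : PlaneMeasure}
    (h : IsVanishingKCarleson 0 (μ.ypow 0)) {ε : ℝ≥0∞} (hε : 0 < ε) :
    ∃ n, ∀ w ∈ upperPlane, w ∉ exhaustion n → μ.density w ≤ ε := by
  by_contra! hcon
  choose w hw hwn hlt using hcon
  obtain ⟨D, hD, hb⟩ := exists_bergmanTest_bound
  have h1 := h.2 (fun n => bergmanTest (w n)) (fun n => (hb _ (hw n)).1)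
    ⟨D, fun n => (hb _ (hw n)).2⟩ (tendstoLocallyUniformlyOn_bergmanTest hw hwn)
  simp only [iteratedDeriv_zero, PlaneMeasure.ypow_zero_variation] at h1
  have h2 := ENNReal.Tendsto.const_mul h1 (a := 81) (Or.inr (by norm_num))
  rw [mul_zero] at h2
  obtain ⟨n, hn⟩ := (h2.eventually_lt_const hε).exists
  exact absurd ((hlt n).trans_le (μ.density_le_lintegral (hw n))) (not_lt.2 hn.le)

theorem measurableSet_mem_ball_im_div : MeasurableSet
    {p : ℂ × ℂ | p.1 ∈ Metric.ball p.2 (p.2.im / 3)} :=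
  (isOpen_lt (continuous_fst.dist continuous_snd)
    ((Complex.continuous_im.comp continuous_snd).div_const 3)).measurableSet

/-- Integrating the sub-mean value inequality against `|μ|` and interchanging the integrals. -/
theorem exists_lintegral_variation_le (n : ℕ) : ∃ C : ℝ≥0∞, C ≠ ⊤ ∧
    ∀ (μ : PlaneMeasure) (f : ℂ → ℂ), IsPolyanalytic n f →
      ∫⁻ z, ‖f z‖ₑ ^ 2 ∂μ.variation ≤ C * ∫⁻ w, ‖f w‖ₑ ^ 2 * μ.density w ∂area := by
  obtain ⟨C, hC, h⟩ := exists_norm_sq_le_setIntegral_ball n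
  refine ⟨ENNReal.ofReal (25 * C), by finiteness, fun μ f hf => ?_⟩
  have hmU : MeasurableSet upperPlane := isOpen_upperPlane.measurableSet
  set φ : ℂ → ℝ≥0∞ :=
    upperPlane.indicator fun w => ‖f w‖ₑ ^ 2 / ENNReal.ofReal (w.im ^ 2) with hφ
  have hφm : Measurable φ := by
    have h1 : Measurable (upperPlane.indicator f) := by
      classical
      rw [← Set.piecewise_eq_indicator]
      exact hf.1.continuousOn.measurable_piecewise continuousOn_const hmU
    have h2 : φ = fun w => ‖upperPlane.indicator f w‖ₑ ^ 2 / ENNReal.ofReal (w.im ^ 2) := by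
      ext w
      by_cases hw : w ∈ upperPlane <;> simp [hφ, hw]
    rw [h2]
    exact (h1.enorm.pow_const 2).div (Complex.measurable_im.pow_const 2).ennreal_ofReal
  set S : Set (ℂ × ℂ) := {p | p.1 ∈ Metric.ball p.2 (p.2.im / 3)} with hS
  have hSm : MeasurableSet S := measurableSet_mem_ball_im_div
  have hFm : Measurable (S.indicator fun p : ℂ × ℂ => φ p.2) :=
    (hφm.comp measurable_snd).indicator hSm
  have hpt : ∀ z ∈ upperPlane, ‖f z‖ₑ ^ 2
      ≤ ENNReal.ofReal (25 * C) * ∫⁻ w, S.indicator (fun p : ℂ × ℂ => φ p.2) (z, w) := by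
    intro z hz
    have hz' : 0 < z.im := hz
    have hb : Metric.closedBall z (z.im / 4) ⊆ upperPlane :=
      closedBall_subset_upperPlane (by linarith)
    have h1 := h f hf z (z.im / 4) (by positivity) hb
    have hi : IntegrableOn (fun w => ‖f w‖ ^ 2) (Metric.ball z (z.im / 4)) :=
      integrableOn_ball_of_continuousOn ((hf.1.continuousOn.mono hb).norm.pow 2)
    have h2 := ofReal_integral_eq_lintegral_ofReal hi (Eventually.of_forall fun _ => by positivity)
    have h3 : ‖f z‖ ^ 2 ≤ (16 * C / z.im ^ 2) * ∫ w in Metric.ball z (z.im / 4), ‖f w‖ ^ 2 := by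
      rw [div_mul_eq_mul_div, le_div_iff₀ (by positivity)]
      linarith
    rw [← ofReal_norm, ← ENNReal.ofReal_pow (norm_nonneg _)]
    refine (ENNReal.ofReal_le_ofReal h3).trans ?_
    rw [ENNReal.ofReal_mul (by positivity), h2, ← lintegral_const_mul' _ _ (by finiteness),
      ← lintegral_const_mul' _ _ (by finiteness), ← lintegral_indicator measurableSet_ball]
    refine lintegral_mono fun w => ?_
    by_cases hw : w ∈ Metric.ball z (z.im / 4)
    · have hwU : w ∈ upperPlane := hb (Metric.ball_subset_closedBall hw)
      have hw0 : 0 < w.im := hwU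
      have h4 : ‖w - z‖ < z.im / 4 := mem_ball_iff_norm.1 hw
      have h5 : |(w - z).im| < z.im / 4 := (Complex.abs_im_le_norm _).trans_lt h4
      rw [Complex.sub_im, abs_lt] at h5
      have hwS : (z, w) ∈ S := by
        change dist z w < w.im / 3
        rw [dist_comm, dist_eq_norm]
        linarith
      -- here `3 / 4 * Im z < Im w < 5 / 4 * Im z`; the second bound gives the constant `25`
      rw [Set.indicator_of_mem hw, Set.indicator_of_mem hwS]
      simp only [hφ]
      rw [Set.indicator_of_mem hwU, ← ofReal_norm, ← ENNReal.ofReal_pow (norm_nonneg _),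
        ← ENNReal.ofReal_div_of_pos (by positivity), ← ENNReal.ofReal_mul (by positivity),
        ← ENNReal.ofReal_mul (by positivity)]
      refine ENNReal.ofReal_le_ofReal ?_
      rw [div_mul_eq_mul_div, mul_div_assoc', div_le_div_iff₀ (by positivity) (by positivity)]
      have h6 : 16 * w.im ^ 2 ≤ 25 * z.im ^ 2 := by nlinarith
      calc 16 * C * ‖f w‖ ^ 2 * w.im ^ 2 = C * ‖f w‖ ^ 2 * (16 * w.im ^ 2) := by ring
        _ ≤ C * ‖f w‖ ^ 2 * (25 * z.im ^ 2) := by gcongr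
        _ = _ := by ring
    · rw [Set.indicator_of_notMem hw]
      exact zero_le
  calc ∫⁻ z, ‖f z‖ₑ ^ 2 ∂μ.variation
      ≤ ∫⁻ z, (ENNReal.ofReal (25 * C) *
          ∫⁻ w, S.indicator (fun p : ℂ × ℂ => φ p.2) (z, w)) ∂μ.variation :=
        lintegral_mono_ae (μ.ae_mem_upperPlane.mono hpt)
    _ = ENNReal.ofReal (25 * C) *
          ∫⁻ w, (∫⁻ z, S.indicator (fun p : ℂ × ℂ => φ p.2) (z, w) ∂μ.variation) := by
        rw [lintegral_const_mul' _ _ (by finiteness),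
          lintegral_lintegral_swap (f := fun z w => S.indicator (fun p : ℂ × ℂ => φ p.2) (z, w))
            hFm.aemeasurable]
    _ = ENNReal.ofReal (25 * C) * ∫⁻ w, ‖f w‖ₑ ^ 2 * μ.density w ∂area := by
        congr 1
        rw [area, ← lintegral_indicator hmU]
        refine lintegral_congr fun w => ?_
        have e : ∀ z, S.indicator (fun p : ℂ × ℂ => φ p.2) (z, w)
            = (Metric.ball w (w.im / 3)).indicator (fun _ => φ w) z := fun z => by
          by_cases hzw : z ∈ Metric.ball w (w.im / 3)
          · have : (z, w) ∈ S := hzw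
            rw [Set.indicator_of_mem this, Set.indicator_of_mem hzw]
          · have : (z, w) ∉ S := hzw
            rw [Set.indicator_of_notMem this, Set.indicator_of_notMem hzw]
        simp_rw [e]
        rw [lintegral_indicator measurableSet_ball, setLIntegral_const]
        by_cases hw : w ∈ upperPlane
        · simp only [hφ, Set.indicator_of_mem hw, PlaneMeasure.density, div_eq_mul_inv]
          ring
        · simp [hφ, hw]

/-! ### Toeplitz operators -/

theorem IsKCarleson.memLp_smoothRep {μ : PlaneMeasure} (h : IsKCarleson 0 (μ.ypow 0)) {n : ℕ}
    (u : trueBergman n) : MemLp (smoothRep u) 2 μ.variation := by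
  refine ⟨μ.aestronglyMeasurable_of_continuousOn (smoothRep_continuousOn u), ?_⟩
  rw [eLpNorm_lt_top_iff_lintegral_rpow_enorm_lt_top (by simp) (by simp)]
  simp only [ENNReal.toReal_ofNat, ENNReal.rpow_ofNat]
  obtain ⟨C, hC, hle⟩ := exists_lintegral_variation_le n
  obtain ⟨M, hM, hd⟩ := h.exists_density_le
  refine (hle μ _ (smoothRep_spec u).1).trans_lt (ENNReal.mul_lt_top hC.lt_top ?_)
  calc ∫⁻ w, ‖smoothRep u w‖ₑ ^ 2 * μ.density w ∂area
      ≤ ∫⁻ w, ‖smoothRep u w‖ₑ ^ 2 * M ∂area :=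
        lintegral_mono_ae (ae_area_mem_upperPlane.mono fun w hw => by gcongr; exact hd w hw)
    _ = ‖u‖ₑ ^ 2 * M := by rw [lintegral_mul_const' _ _ hM, enorm_sq_eq_lintegral_smoothRep]
    _ < ⊤ := by finiteness

theorem memLp_phase_mul (μ : PlaneMeasure) (v : Lp ℂ 2 μ.variation) :
    MemLp (fun z => μ.phase z * v z) 2 μ.variation :=
  (Lp.memLp v).of_le (μ.measurable_phase.aestronglyMeasurable.mul (Lp.aestronglyMeasurable v))
    (Eventually.of_forall fun z => by rw [norm_mul, μ.norm_phase, one_mul])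

/-- Multiplication by the phase of `μ` on `L²(|μ|)`. -/
def mulPhase (μ : PlaneMeasure) : Lp ℂ 2 μ.variation →L[ℂ] Lp ℂ 2 μ.variation :=
  LinearMap.mkContinuous
    { toFun := fun v => (memLp_phase_mul μ v).toLp
      map_add' := fun v w => by
        rw [← MemLp.toLp_add]
        refine MemLp.toLp_congr _ _ ((Lp.coeFn_add v w).mono fun z hz => ?_)
        simp only [hz, Pi.add_apply, mul_add]
      map_smul' := fun c v => by
        rw [RingHom.id_apply, ← MemLp.toLp_const_smul]
        refine MemLp.toLp_congr _ _ ((Lp.coeFn_smul c v).mono fun z hz => ?_)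
        simp only [hz, Pi.smul_apply, smul_eq_mul, mul_left_comm] } 1 fun v => by
    rw [one_mul]
    refine Lp.norm_le_norm_of_ae_le ((memLp_phase_mul μ v).coeFn_toLp.mono fun z hz => ?_)
    exact (congrArg norm hz).le.trans (by rw [norm_mul, μ.norm_phase, one_mul])

theorem coeFn_mulPhase (μ : PlaneMeasure) (v : Lp ℂ 2 μ.variation) :
    mulPhase μ v =ᵐ[μ.variation] fun z => μ.phase z * v z :=
  (memLp_phase_mul μ v).coeFn_toLp

/-- The Toeplitz operator `J* ∘ (phase of μ) ∘ J`, where `J` is the embedding into `L²(|μ|)`. -/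
def toeplitz {n : ℕ} (μ : PlaneMeasure)
    (hμ : ∀ u : trueBergman n, MemLp (smoothRep u) 2 μ.variation) :
    trueBergman n →L[ℂ] trueBergman n :=
  ContinuousLinearMap.adjoint (embedding μ hμ) ∘L mulPhase μ ∘L embedding μ hμ

theorem isToeplitz_toeplitz {n : ℕ} (μ : PlaneMeasure)
    (hμ : ∀ u : trueBergman n, MemLp (smoothRep u) 2 μ.variation) :
    IsToeplitz μ (toeplitz μ hμ) := by
  intro u v
  rw [toeplitz, ContinuousLinearMap.comp_apply, ContinuousLinearMap.adjoint_inner_right,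
    L2.inner_def, form, PlaneMeasure.integral]
  refine integral_congr_ae ?_
  filter_upwards [coeFn_mulPhase μ (embedding μ hμ u), coeFn_embedding μ hμ u,
    coeFn_embedding μ hμ v] with z h1 h2 h3
  rw [ContinuousLinearMap.comp_apply, h1, h2, h3, RCLike.inner_apply]
  ring

theorem IsToeplitz.unique {n : ℕ} {μ : PlaneMeasure} {T S : trueBergman n →L[ℂ] trueBergman n}
    (hT : IsToeplitz μ T) (hS : IsToeplitz μ S) : T = S :=
  ContinuousLinearMap.ext fun u => ext_inner_left ℂ fun v => (hT u v).trans (hS u v).symm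

/-- An operator on a separable Hilbert space which maps bounded weakly null sequences to null
sequences is compact. -/
theorem isCompactOperator_of_weakly_null {E F : Type*} [NormedAddCommGroup E]
    [InnerProductSpace ℂ E] [CompleteSpace E] [TopologicalSpace.SeparableSpace E]
    [NormedAddCommGroup F] [NormedSpace ℂ F] (L : E →L[ℂ] F)
    (hL : ∀ x : ℕ → E, (∃ M, ∀ k, ‖x k‖ ≤ M) → (∀ φ : E →L[ℂ] ℂ, Tendsto (fun k => φ (x k)) atTop
      (𝓝 0)) → Tendsto (fun k => L (x k)) atTop (𝓝 0)) : IsCompactOperator L := by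
  refine (isCompactOperator_iff_image_closedBall_subset_compact L.toLinearMap one_pos).2
    ⟨L '' Metric.closedBall 0 1, IsSeqCompact.isCompact fun y hy => ?_, subset_rfl⟩
  choose x hx hxy using hy
  have hx1 : ∀ k, ‖x k‖ ≤ 1 := fun k => by simpa using hx k
  obtain ⟨φ, hφ, ns, hns, hlim⟩ := WeakDual.isSeqCompact_closedBall ℂ E 0 1
    (x := fun k => StrongDual.toWeakDual (InnerProductSpace.toDual ℂ E (x k)))
    (fun k => by simpa using hx1 k)
  set x₀ := (InnerProductSpace.toDual ℂ E).symm (WeakDual.toStrongDual φ) with hx₀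
  have hx₀1 : ‖x₀‖ ≤ 1 := by simpa [hx₀] using hφ
  refine ⟨L x₀, ⟨x₀, by simpa using hx₀1, rfl⟩, ns, hns, ?_⟩
  have key := hL (fun k => x (ns k) - x₀) ⟨1 + 1, fun k => (norm_sub_le _ _).trans
    (add_le_add (hx1 _) hx₀1)⟩ fun ψ => by
      set v := (InnerProductSpace.toDual ℂ E).symm ψ with hv
      have hψ : ∀ w, ψ w = ⟪v, w⟫_ℂ := fun w => by simp [hv]
      have h1 : Tendsto (fun k => ⟪x (ns k), v⟫_ℂ) atTop (𝓝 ⟪x₀, v⟫_ℂ) := by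
        have := ((WeakDual.eval_continuous v).tendsto φ).comp hlim
        have e : ⟪x₀, v⟫_ℂ = φ v := by simp [hx₀]
        rw [e]
        exact this
      have h2 := (Complex.continuous_conj.tendsto _).comp h1
      simp only [Function.comp_def, inner_conj_symm] at h2
      simp_rw [hψ, inner_sub_right]
      simpa using h2.sub_const ⟪v, x₀⟫_ℂ
  have h3 := key.add_const (L x₀)
  simpa [Function.comp_def, ← hxy] using h3

/-- The part of the norm of `J u` coming from a compact set tends to `0` by dominated convergence;
outside of it the density of `|μ|` is small. -/
theorem IsVanishingKCarleson.tendsto_embedding {μ : PlaneMeasure}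
    (h : IsVanishingKCarleson 0 (μ.ypow 0)) {n : ℕ}
    (hμ : ∀ u : trueBergman n, MemLp (smoothRep u) 2 μ.variation) {u : ℕ → trueBergman n} {M : ℝ}
    (hM : ∀ k, ‖u k‖ ≤ M)
    (hu : ∀ z ∈ upperPlane, Tendsto (fun k => smoothRep (u k) z) atTop (𝓝 0)) :
    Tendsto (fun k => embedding μ hμ (u k)) atTop (𝓝 0) := by
  obtain ⟨C, hC, hle⟩ := exists_lintegral_variation_le n
  obtain ⟨D, hD, hDle⟩ := h.1.exists_density_le
  obtain ⟨B, hB, hBle⟩ := exists_norm_smoothRep_mul_im_le n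
  have hM0 : 0 ≤ M := (norm_nonneg _).trans (hM 0)
  have hMe : ∀ k, ‖u k‖ₑ ^ 2 ≤ ENNReal.ofReal M ^ 2 := fun k => by
    rw [← ofReal_norm]
    gcongr
    exact hM k
  -- dominated convergence on the compact sets of the exhaustion
  have hcpt : ∀ N, Tendsto (fun k => ∫⁻ w in exhaustion N, ‖smoothRep (u k) w‖ₑ ^ 2) atTop
      (𝓝 0) := by
    intro N
    have hmeas : MeasurableSet (exhaustion N) := (isCompact_exhaustion N).measurableSet
    have h0 : ∫⁻ _ in exhaustion N, (0 : ℝ≥0∞) = 0 := by simp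
    rw [← h0]
    refine tendsto_lintegral_of_dominated_convergence'
      (fun _ => ENNReal.ofReal (B * M * (N + 1)) ^ 2) (fun k => ?_) (fun k => ?_) ?_ ?_
    · exact (((smoothRep_continuousOn (u k)).mono (exhaustion_subset N)).aestronglyMeasurable
        hmeas).enorm.pow_const 2
    · refine (ae_restrict_iff' hmeas).2 (Eventually.of_forall fun w hw => ?_)
      beta_reduce
      rw [← ofReal_norm]
      gcongr
      have h1 := hBle (u k) w (exhaustion_subset N hw)
      have h2 : 1 / ((N : ℝ) + 1) ≤ w.im := hw.1
      have h3 : ‖smoothRep (u k) w‖ * (1 / ((N : ℝ) + 1)) ≤ B * M :=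
        (mul_le_mul_of_nonneg_left h2 (norm_nonneg _)).trans
          (h1.trans (mul_le_mul_of_nonneg_left (hM k) hB.le))
      rwa [mul_one_div, div_le_iff₀ (by positivity)] at h3
    · rw [setLIntegral_const]
      have := (isCompact_exhaustion N).measure_lt_top (μ := volume)
      finiteness
    · refine (ae_restrict_iff' hmeas).2 (Eventually.of_forall fun w hw => ?_)
      have := ENNReal.Tendsto.pow (n := 2)
        ((continuous_enorm.tendsto _).comp (hu w (exhaustion_subset N hw)))
      simpa [Function.comp_def] using this
  have hsq : Tendsto (fun k => ‖embedding μ hμ (u k)‖ₑ ^ 2) atTop (𝓝 0) := by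
    refine ENNReal.tendsto_nhds_zero.2 fun ε hε => ?_
    rcases eq_or_ne ε ⊤ with rfl | hεt
    · simp
    -- `δ` is chosen so that the part outside the compact set is at most `ε / 2`
    set δ : ℝ≥0∞ := ε / 2 / (C * ENNReal.ofReal M ^ 2 + 1) with hδ
    have hA : C * ENNReal.ofReal M ^ 2 + 1 ≠ ⊤ := by finiteness
    have hδ0 : 0 < δ := ENNReal.div_pos (ENNReal.half_pos hε.ne').ne' hA
    obtain ⟨N, hN⟩ := h.exists_density_le hδ0
    have hlim : Tendsto (fun k => C * (D * ∫⁻ w in exhaustion N, ‖smoothRep (u k) w‖ₑ ^ 2))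
        atTop (𝓝 0) := by
      have := ENNReal.Tendsto.const_mul (ENNReal.Tendsto.const_mul (hcpt N) (Or.inr hD))
        (Or.inr hC)
      simpa using this
    filter_upwards [ENNReal.tendsto_nhds_zero.1 hlim (ε / 2) (ENNReal.half_pos hε.ne')] with k hk
    have hmeas : MeasurableSet (exhaustion N) := (isCompact_exhaustion N).measurableSet
    have hpt : ∀ w ∈ upperPlane, ‖smoothRep (u k) w‖ₑ ^ 2 * μ.density w
        ≤ (exhaustion N).indicator (fun w => D * ‖smoothRep (u k) w‖ₑ ^ 2) w
          + δ * ‖smoothRep (u k) w‖ₑ ^ 2 := by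
      intro w hw
      by_cases hwN : w ∈ exhaustion N
      · rw [Set.indicator_of_mem hwN, mul_comm]
        refine le_add_right ?_
        gcongr
        exact hDle w hw
      · rw [Set.indicator_of_notMem hwN, zero_add, mul_comm]
        gcongr
        exact hN w hw hwN
    have hint : ∫⁻ w, ‖smoothRep (u k) w‖ₑ ^ 2 * μ.density w ∂area
        ≤ D * (∫⁻ w in exhaustion N, ‖smoothRep (u k) w‖ₑ ^ 2) + δ * ‖u k‖ₑ ^ 2 := by
      refine (lintegral_mono_ae (ae_area_mem_upperPlane.mono hpt)).trans_eq ?_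
      have hδt : δ ≠ ⊤ := ENNReal.div_ne_top (by finiteness) (by simp)
      rw [lintegral_add_right', lintegral_const_mul' _ _ hδt, enorm_sq_eq_lintegral_smoothRep,
        lintegral_indicator hmeas, lintegral_const_mul' _ _ hD, area,
        Measure.restrict_restrict_of_subset (exhaustion_subset N)]
      exact ((memLp_smoothRep_area (u k)).1.enorm.pow_const 2).const_mul _
    rw [enorm_embedding_sq]
    calc ∫⁻ z, ‖smoothRep (u k) z‖ₑ ^ 2 ∂μ.variation
        ≤ C * (D * (∫⁻ w in exhaustion N, ‖smoothRep (u k) w‖ₑ ^ 2) + δ * ‖u k‖ₑ ^ 2) :=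
          (hle μ _ (smoothRep_spec (u k)).1).trans (by gcongr)
      _ ≤ ε / 2 + δ * (C * ENNReal.ofReal M ^ 2 + 1) := by
          rw [mul_add]
          refine add_le_add hk ?_
          rw [mul_left_comm]
          gcongr
          exact le_add_right (mul_le_mul_right (hMe k) C)
      _ ≤ ε / 2 + ε / 2 := by rw [ENNReal.div_mul_cancel (by simp) hA]
      _ = ε := ENNReal.add_halves ε
  have h1 : Tendsto (fun k => (‖embedding μ hμ (u k)‖ₑ ^ 2) ^ (1 / 2 : ℝ)) atTop (𝓝 0) := by
    have := ((ENNReal.continuous_rpow_const (y := 1 / 2)).tendsto _).comp hsq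
    simpa [Function.comp_def] using this
  have h2 : ∀ x : ℝ≥0∞, (x ^ 2) ^ (1 / 2 : ℝ) = x := fun x => by
    rw [← ENNReal.rpow_natCast, ← ENNReal.rpow_mul]; simp
  simp_rw [h2] at h1
  exact tendsto_zero_iff_enorm_tendsto_zero.2 h1

theorem IsVanishingKCarleson.isCompactOperator_embedding {μ : PlaneMeasure}
    (h : IsVanishingKCarleson 0 (μ.ypow 0)) {n : ℕ}
    (hμ : ∀ u : trueBergman n, MemLp (smoothRep u) 2 μ.variation) :
    IsCompactOperator (embedding μ hμ) := by
  have : Fact ((2 : ℝ≥0∞) ≠ ⊤) := ⟨by simp⟩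
  have : SFinite area := by unfold area; infer_instance
  refine isCompactOperator_of_weakly_null _ fun u ⟨M, hM⟩ hu => ?_
  exact h.tendsto_embedding hμ hM fun z hz => hu (evalCLM n hz)

end PolyBergman

end

theorem mainTheorem4 (j : ℕ) (μ : PolyBergman.PlaneMeasure)
    (hμ : ∀ k ≤ 2 * j, PolyBergman.IsKCarleson k (μ.ypow k)) :
    (∀ u v : PolyBergman.trueBergman (j + 1),
      Integrable (fun z => PolyBergman.smoothRep u z * conj (PolyBergman.smoothRep v z))
        μ.variation) ∧
    (∃ C : ℝ, ∀ u v : PolyBergman.trueBergman (j + 1),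
      ‖PolyBergman.form μ u v‖ ≤ C * ‖u‖ * ‖v‖) ∧
    (∃! T : PolyBergman.trueBergman (j + 1) →L[ℂ] PolyBergman.trueBergman (j + 1),
      PolyBergman.IsToeplitz μ T) ∧
    ((∀ k ≤ 2 * j, PolyBergman.IsVanishingKCarleson k (μ.ypow k)) →
      ∀ T : PolyBergman.trueBergman (j + 1) →L[ℂ] PolyBergman.trueBergman (j + 1),
        PolyBergman.IsToeplitz μ T → IsCompactOperator T) := by
  have hmem : ∀ u : PolyBergman.trueBergman (j + 1),
      MemLp (PolyBergman.smoothRep u) 2 μ.variation := (hμ 0 (Nat.zero_le _)).memLp_smoothRep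
  have hT := PolyBergman.isToeplitz_toeplitz μ hmem
  refine ⟨fun u v => (hmem u).integrable_mul (hmem v).star,
    ⟨‖PolyBergman.toeplitz μ hmem‖, fun u v => ?_⟩, ⟨_, hT, fun S hS => hS.unique hT⟩,
    fun hv T hT' => ?_⟩
  · rw [← hT u v, mul_comm]
    refine (norm_inner_le_norm (𝕜 := ℂ) v (PolyBergman.toeplitz μ hmem u)).trans ?_
    gcongr
    exact ContinuousLinearMap.le_opNorm _ u
  · rw [hT'.unique hT]
    exact ((hv 0 (Nat.zero_le _)).isCompactOperator_embedding hmem).clm_comp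
      (ContinuousLinearMap.adjoint (PolyBergman.embedding μ hmem) ∘L PolyBergman.mulPhase μ)
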